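/- Let $K=\{0,\alpha,\beta,\gamma\}$ be a $2$-dimensional vector space over $\mathrm{GF}(2)$ with the bilinear form $\langle x,y\rangle_K=1$ if and only if $0\neq x\neq y\neq 0$. For a finite set $V$, equip $K^V$ with $\langle a,b\rangle=\sum_{v\in V}\langle a(v),b(v)\rangle_K$, and write $\mathrm{supp}(a)=\{v: a(v)\ne 0\}$. An isotropic system $S=(V,L)$ is a finite set $V$ with a subspace $L\subseteq K^V$ such that $\langle a,b\rangle=0$ for all $a,b\in L$ and $\dim L=|V|$. For $v\in V$ and $x\in K\setminus\{0\}$, the elementary minor $S|^v_x$ is the isotropic system on $V\setminus\{v\}$ whose subspace consists of the restrictions to $V\setminus\{v\}$ of all $a\in L$ with $a(v)\in\{0,x\}$. Put $c_S(X)=|X|-\dim\{a|_X: a\in L,\ \mathrm{supp}(a)\subseteq X\}$ for $X\subseteq V$. A $k$-separation of $S$ is a partition $(X,Y)$ of $V$ with $\min\{|X|,|Y|\}\ge k$ and $c_S(X)<k$, and $S$ is $k$-connected if it has no $k'$-separation with $1\le k'<k$. A vertex $v\in V$ is non-essential if at least two of $S|^v_\alpha,S|^v_\beta,S|^v_\gamma$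 are $3$-connected. A vector $a\in K^V$ is Eulerian for $S$ if $\mathrm{supp}(a)=V$ and, for every nonempty $X\subseteq V$, the vector that agrees with $a$ on $X$ and is $0$ off $X$ is not in $L$. For such $a$ and each $v\in V$ there is a unique $b_v\in L$ with $\langle b_v(v),a(v)\rangle_K=1$ and $\langle b_v(w),a(w)\rangle_K=0$ for all $w\ne v$; the fundamental graph of $S$ with respect to $a$ is the graph on $V$ in which distinct $v,w$ are adjacent if and only if $b_v(w)\neq0$. $S$ is cyclic if one of its fundamental graphs is a cycle graph of length at least $5$. The triangle hypergraph $H(S)$ is the $3$-uniform hypergraph on $V$ whose edges are the supports of size $3$ of vectors in $L$. Let $H$ be a $3$-uniform hypergraph and $N\subseteq V(H)$. A partial hypergraph of $H$ is a hypergraph $P$ with $V(P)\subseteq V(H)$ and $E(P)\subseteq E(H)$; the one generated by $F\subseteq E(H)$ is $(\bigcup_{e\in F}e,\,F)$. A tight path of length $k\ge1$ in $H$ is a partial hypergraph $P$ that admits an ordering $v_0,\dots,v_{k+1}$ of its (distinct) vertices with $E(P)=\{\{v_{i-1},v_i,v_{i+1}\}:1\le i\le k\}$; its ends are the vertices incident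 with exactly one edge of $P$, and its internal vertices are those incident with at least two. * An $N$-ear in $H$ is a tight path $P$ of length at least $2$ whose ends are in $N$, whose internal vertices are in $V(H)\setminus N$, and such that no edge in $E(H)\setminus E(P)$ is incident with an internal vertex of $P$. * An $N$-triangle in $H$ is a partial hypergraph generated by $\{e\}$ for an edge $e\subseteq N$ of $H$ such that no edge $e'$ of $H$ has $|e\cap e'|=2$. * An $N$-windmill in $H$ is a partial hypergraph generated by the set $X$ of all edges of $H$ incident with some vertex $v\in V(H)\setminus N$, where $X\neq\emptyset$, for every $e\in X$ we have $e\setminus\{v\}\subseteq N$ and $e$ is the unique edge of $H$ containing $e\setminus\{v\}$, and $e\cap e'=\{v\}$ for all distinct $e,e'\in X$. * An $N$-tripod in $H$ is a partial hypergraph generated by the set $X$ of all edges of $H$ incident with $v$ or $w$ for some distinct $v,w\in V(H)\setminus N$, where $|X|=3$ and $\{v,w\}\subseteq e\subseteq N\cup\{v,w\}$ for every $e\in X$. * An $N$-table in $H$ is a partial hypergraph generated by the set $X$ of all edges of $H$ intersecting some edge $f\subseteq V(H)\setminus N$ of $H$, where $|X|=4$, $|e\cap f|\ge2$ and $e\setminus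 f\subseteq N$ for every $e\in X$, and $e\setminus f\ne e'\setminus f$ for all distinct $e,e'\in X$. **Theorem.** Let $S$ be a $3$-connected isotropic system with at least $5$ vertices, and let $N$ be its set of non-essential vertices. If $S$ is not cyclic, then the edge set of $H(S)$ is the union of the edge sets of all $N$-ears, $N$-triangles, $N$-windmills, $N$-tripods and $N$-tables in $H(S)$. -/

import Mathlib

/-! ## Hypergraphs, tight paths and the five kinds of partial hypergraphs -/

namespace Hypergraph

variable {V : Type*}

/-- `H` is `k`-uniform: every edge has exactly `k` elements. -/
def IsUniform (H : Hypergraph V) (k : ℕ) : Prop :=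
  ∀ e ∈ H.edgeSet, e.ncard = k

/-- `P` is a partial hypergraph of `H`. -/
def IsPartial (P H : Hypergraph V) : Prop :=
  P.vertexSet ⊆ H.vertexSet ∧ P.edgeSet ⊆ H.edgeSet

/-- The hypergraph `(⋃_{e ∈ F} e, F)`. -/
def generatedBy (F : Set (Set V)) : Hypergraph V where
  vertexSet := ⋃₀ F
  edgeSet := F
  subset_vertexSet_of_mem_edgeSet' := fun _ he => Set.subset_sUnion_of_mem he

/-- `P` is a tight path of length `k` in `H`: `k ≥ 1`, `P` is a partial hypergraph of `H`, and there
is an ordering `v₀, v₁, …, v_{k+1}` of the vertices of `P` such that the edges of `P` are exactly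
the sets `{v_{i-1}, v_i, v_{i+1}}` for `1 ≤ i ≤ k`. -/
def IsTightPath (H P : Hypergraph V) (k : ℕ) : Prop :=
  1 ≤ k ∧ P.IsPartial H ∧
    ∃ v : Fin (k + 2) → V, Function.Injective v ∧ P.vertexSet = Set.range v ∧
      P.edgeSet =
        Set.range fun i : Fin k => {v i.castSucc.castSucc, v i.castSucc.succ, v i.succ.succ}

/-- An end of `P`: a vertex incident with exactly one edge of `P`. -/
def IsEnd (P : Hypergraph V) (v : V) : Prop :=
  v ∈ P.vertexSet ∧ ∃! e, e ∈ P.edgeSet ∧ v ∈ e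

/-- An internal vertex of `P`: a vertex incident with at least two edges of `P`. -/
def IsInternal (P : Hypergraph V) (v : V) : Prop :=
  v ∈ P.vertexSet ∧
    ∃ e ∈ P.edgeSet, ∃ f ∈ P.edgeSet, e ≠ f ∧ v ∈ e ∧ v ∈ f

/-- `P` is an `N`-ear in `H`. -/
def IsEar (H : Hypergraph V) (N : Set V) (P : Hypergraph V) : Prop :=
  (∃ k, 2 ≤ k ∧ H.IsTightPath P k) ∧
    (∀ v, P.IsEnd v → v ∈ N) ∧
    (∀ v, P.IsInternal v → v ∉ N) ∧
    ∀ e ∈ H.edgeSet, e ∉ P.edgeSet → ∀ v, P.IsInternal v → v ∉ e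

/-- `P` is an `N`-triangle in `H`. -/
def IsTriangle (H : Hypergraph V) (N : Set V) (P : Hypergraph V) : Prop :=
  ∃ e ∈ H.edgeSet, e ⊆ N ∧ (¬ ∃ e' ∈ H.edgeSet, (e ∩ e').ncard = 2) ∧ P = generatedBy {e}

/-- `P` is an `N`-windmill in `H`. -/
def IsWindmill (H : Hypergraph V) (N : Set V) (P : Hypergraph V) : Prop :=
  ∃ v ∈ H.vertexSet \ N, ∃ X : Set (Set V),
    X = {e | e ∈ H.edgeSet ∧ v ∈ e} ∧ X.Nonempty ∧
    (∀ e ∈ X, e \ {v} ⊆ N ∧ ∀ e' ∈ H.edgeSet, e \ {v} ⊆ e' → e' = e) ∧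
    (∀ e ∈ X, ∀ e' ∈ X, e ≠ e' → e ∩ e' = {v}) ∧
    P = generatedBy X

/-- `P` is an `N`-tripod in `H`. -/
def IsTripod (H : Hypergraph V) (N : Set V) (P : Hypergraph V) : Prop :=
  ∃ v ∈ H.vertexSet \ N, ∃ w ∈ H.vertexSet \ N, v ≠ w ∧ ∃ X : Set (Set V),
    X = {e | e ∈ H.edgeSet ∧ (v ∈ e ∨ w ∈ e)} ∧ X.ncard = 3 ∧
    (∀ e ∈ X, {v, w} ⊆ e ∧ e ⊆ N ∪ {v, w}) ∧
    P = generatedBy X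

/-- `P` is an `N`-table in `H`. -/
def IsTable (H : Hypergraph V) (N : Set V) (P : Hypergraph V) : Prop :=
  ∃ f ∈ H.edgeSet, f ⊆ H.vertexSet \ N ∧ ∃ X : Set (Set V),
    X = {e | e ∈ H.edgeSet ∧ (e ∩ f).Nonempty} ∧ X.ncard = 4 ∧
    (∀ e ∈ X, 2 ≤ (e ∩ f).ncard ∧ e \ f ⊆ N) ∧
    (∀ e ∈ X, ∀ e' ∈ X, e ≠ e' → e \ f ≠ e' \ f) ∧
    P = generatedBy X

end Hypergraph

/-! ## Isotropic systems -/

namespace IsotropicSystem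

/-- The two-dimensional vector space `K = {0, α, β, γ}` over `GF(2)`; the nonzero elements
`(1, 0)`, `(0, 1)`, `(1, 1)` are `α`, `β`, `γ`. -/
abbrev K : Type := ZMod 2 × ZMod 2

/-- The bilinear form on `K`. -/
def formK : LinearMap.BilinForm (ZMod 2) K :=
  LinearMap.mk₂ (ZMod 2) (fun x y => x.1 * y.2 + x.2 * y.1)
    (by intros; simp; ring) (by intros; simp; ring) (by intros; simp; ring) (by intros; simp; ring)

/-- `⟨x, y⟩ = 1` if and only if `0 ≠ x ≠ y ≠ 0`. -/
theorem formK_eq_one_iff (x y : K) : formK x y = 1 ↔ x ≠ 0 ∧ x ≠ y ∧ y ≠ 0 := by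
  change x.1 * y.2 + x.2 * y.1 = 1 ↔ _
  revert x y
  decide

theorem formK_eq_zero_of_mem {x y z : K} (hy : y = 0 ∨ y = x) (hz : z = 0 ∨ z = x) :
    formK y z = 0 := by
  change y.1 * z.2 + y.2 * z.1 = 0
  revert x y z
  decide

theorem eq_zero_or_eq_iff {x : K} (hx : x ≠ 0) (y : K) : (y = 0 ∨ y = x) ↔ formK y x = 0 := by
  change _ ↔ y.1 * x.2 + y.2 * x.1 = 0
  revert x y
  decide

variable {V : Type*}

section Form

variable [Fintype V]

/-- The bilinear form `⟨a, b⟩ = ∑_{v ∈ V} ⟨a(v), b(v)⟩` on `K^V`. -/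
def form : LinearMap.BilinForm (ZMod 2) (V → K) :=
  LinearMap.mk₂ (ZMod 2) (fun a b => ∑ v, formK (a v) (b v))
    (by intros; simp [Finset.sum_add_distrib]) (by intros; simp [Finset.mul_sum])
    (by intros; simp [Finset.sum_add_distrib]) (by intros; simp [Finset.mul_sum])

theorem form_apply (a b : V → K) : form a b = ∑ v, formK (a v) (b v) := rfl

/-- `L` is totally isotropic. -/
def IsTotallyIsotropic (L : Submodule (ZMod 2) (V → K)) : Prop :=
  ∀ a ∈ L, ∀ b ∈ L, form a b = 0

end Form

/-- The projection `p_X : K^V → K^X`, for `X` given by a predicate. -/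
def proj (p : V → Prop) : (V → K) →ₗ[ZMod 2] ({v // p v} → K) :=
  LinearMap.funLeft (ZMod 2) K Subtype.val

/-- The subspace of all vectors `a` with `a(v) ∈ {0, x}`. -/
def valueIn (v : V) (x : K) : Submodule (ZMod 2) (V → K) where
  carrier := {a | a v = 0 ∨ a v = x}
  add_mem' := by
    intro a b ha hb
    change a v + b v = 0 ∨ a v + b v = x
    simp only [Set.mem_ofPred_eq] at ha hb
    generalize a v = y at *
    generalize b v = z at *
    revert x y z
    decide
  zero_mem' := Or.inl rfl
  smul_mem' := by
    intro c a ha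
    change c • a v = 0 ∨ c • a v = x
    simp only [Set.mem_ofPred_eq] at ha
    generalize a v = y at *
    revert c x y
    decide

/-- The subspace of all vectors whose support is contained in `X`. -/
def supportedIn (X : Set V) : Submodule (ZMod 2) (V → K) where
  carrier := {a | Function.support a ⊆ X}
  add_mem' := by
    intro a b ha hb
    exact (Function.support_add a b).trans (Set.union_subset ha hb)
  zero_mem' := by simp
  smul_mem' := by
    intro c a ha
    exact (Function.support_const_smul_subset c a).trans ha

/-- `L|^v_x = {p_{V - v}(a) : a ∈ L, a(v) ∈ {0, x}}`. -/
def minorSpace (L : Submodule (ZMod 2) (V → K)) (v : V) (x : K) :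
    Submodule (ZMod 2) ({w // w ≠ v} → K) :=
  (L ⊓ valueIn v x).map (proj fun w => w ≠ v)

/-- `L|_{⊆ X} = {p_X(a) : a ∈ L, supp(a) ⊆ X}`. -/
def restrictSub (L : Submodule (ZMod 2) (V → K)) (X : Set V) :
    Submodule (ZMod 2) ({w // w ∈ X} → K) :=
  (L ⊓ supportedIn X).map (proj fun w => w ∈ X)

end IsotropicSystem

/-- An isotropic system `S = (V, L)`: a totally isotropic subspace `L` of `K^V` of dimension
`|V|`. -/
structure IsotropicSystem (V : Type*) [Fintype V] where
  /-- the subspace `L` -/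
  space : Submodule (ZMod 2) (V → IsotropicSystem.K)
  isotropic : IsotropicSystem.IsTotallyIsotropic space
  finrank_eq : Module.finrank (ZMod 2) space = Fintype.card V

namespace IsotropicSystem

variable {V : Type*} [Fintype V]

/-- A totally isotropic subspace has dimension at most `|V|`. -/
theorem IsTotallyIsotropic.finrank_le {L : Submodule (ZMod 2) (V → K)}
    (hL : IsTotallyIsotropic L) : Module.finrank (ZMod 2) L ≤ Fintype.card V := by
  classical
  have hker : LinearMap.ker (form (V := V)) = ⊥ := by
    rw [eq_bot_iff]
    intro a ha
    rw [LinearMap.mem_ker] at ha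
    rw [Submodule.mem_bot]
    funext v
    have key : ∀ y : K, formK (a v) y = 0 := by
      intro y
      have h : form a (Pi.single v y) = 0 := by rw [ha]; rfl
      rw [form_apply, Finset.sum_eq_single v] at h
      · simpa using h
      · intro w _ hw
        simp [Pi.single_eq_of_ne hw]
      · simp
    have h1 := key (1, 0)
    have h2 := key (0, 1)
    change (a v).1 * 0 + (a v).2 * 1 = 0 at h1
    change (a v).1 * 1 + (a v).2 * 0 = 0 at h2
    ext
    · simpa using h2
    · simpa using h1
  have h := LinearMap.BilinForm.finrank_add_finrank_orthogonal' (B := form (V := V)) L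
  rw [hker, inf_bot_eq, finrank_bot, add_zero] at h
  have hle : L ≤ LinearMap.BilinForm.orthogonal form L := fun a ha b hb => hL b hb a ha
  have h2 := Submodule.finrank_mono hle
  have h3 : Module.finrank (ZMod 2) (V → K) = Fintype.card V * 2 := by
    rw [Module.finrank_pi_fintype]
    simp
  lia

variable [DecidableEq V]

theorem minorSpace_isotropic (S : IsotropicSystem V) (v : V) (x : K) :
    IsTotallyIsotropic (minorSpace S.space v x) := by
  rintro _ ⟨a, ⟨ha, hav⟩, rfl⟩ _ ⟨b, ⟨hb, hbv⟩, rfl⟩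
  have h := S.isotropic a ha b hb
  rw [form_apply, Fintype.sum_eq_add_sum_subtype_ne _ v, formK_eq_zero_of_mem hav hbv,
    zero_add] at h
  exact h

theorem minorSpace_finrank (S : IsotropicSystem V) (v : V) (x : K) (hx : x ≠ 0) :
    Module.finrank (ZMod 2) (minorSpace S.space v x) = Fintype.card {w // w ≠ v} := by
  apply le_antisymm (minorSpace_isotropic S v x).finrank_le
  have hcard : Fintype.card {w // w ≠ v} = Fintype.card V - 1 := by
    rw [Fintype.card_subtype_compl]
    simp
  rw [hcard, Nat.sub_le_iff_le_add]
  set L' := S.space ⊓ valueIn v x with hL'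
  set f := (proj fun w => w ≠ v).domRestrict L' with hf
  have hrange : LinearMap.range f = minorSpace S.space v x := by
    rw [hf, LinearMap.range_domRestrict]
    rfl
  have hrn := LinearMap.finrank_range_add_finrank_ker f
  rw [hrange] at hrn
  have hform : ∀ a : V → K, form a (Pi.single v x) = formK (a v) x := by
    intro a
    rw [form_apply, Finset.sum_eq_single v]
    · simp
    · intro w _ hw
      simp [Pi.single_eq_of_ne hw]
    · simp
  have hkerf : ∀ a : L', a ∈ LinearMap.ker f → a = 0 ∨ (a : V → K) = Pi.single v x := by
    intro a ha
    rw [LinearMap.mem_ker] at ha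
    have h0 : ∀ w, w ≠ v → (a : V → K) w = 0 := fun w hw => congrFun ha ⟨w, hw⟩
    rcases a.2.2 with h | h
    · left
      ext1
      funext w
      by_cases hw : w = v
      · subst hw; exact h
      · exact h0 w hw
    · right
      funext w
      by_cases hw : w = v
      · subst hw; simpa using h
      · rw [h0 w hw, Pi.single_eq_of_ne hw]
  by_cases hmem : Pi.single v x ∈ S.space
  · have hLe : L' = S.space := by
      rw [hL', inf_eq_left]
      intro a ha
      have h := S.isotropic a ha _ hmem
      rw [hform] at h
      exact (eq_zero_or_eq_iff hx _).2 h
    have hker1 : Module.finrank (ZMod 2) (LinearMap.ker f) ≤ 1 := by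
      have hx' : (Pi.single v x : V → K) ∈ L' := hLe ▸ hmem
      have : LinearMap.ker f ≤ Submodule.span (ZMod 2) {(⟨Pi.single v x, hx'⟩ : L')} := by
        intro a ha
        rcases hkerf a ha with h | h
        · rw [h]; exact zero_mem _
        · have : a = ⟨Pi.single v x, hx'⟩ := Subtype.ext h
          rw [this]
          exact Submodule.mem_span_singleton_self _
      refine (Submodule.finrank_mono this).trans ?_
      exact (finrank_span_le_card _).trans (by simp)
    have : Module.finrank (ZMod 2) L' = Fintype.card V := by rw [hLe]; exact S.finrank_eq
    omega
  · have hker0 : LinearMap.ker f = ⊥ := by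
      rw [eq_bot_iff]
      intro a ha
      rcases hkerf a ha with h | h
      · exact h
      · exact absurd (h ▸ a.2.1) hmem
    rw [hker0, finrank_bot] at hrn
    set φ := ((form (V := V)).flip (Pi.single v x)).domRestrict S.space with hφ
    have hφn := LinearMap.finrank_range_add_finrank_ker φ
    have h1 : Module.finrank (ZMod 2) (LinearMap.range φ) ≤ 1 := by
      refine (Submodule.finrank_le _).trans ?_
      simp
    have h2 : Module.finrank (ZMod 2) (LinearMap.ker φ) ≤ Module.finrank (ZMod 2) L' := by
      rw [← Submodule.finrank_map_subtype_eq S.space (LinearMap.ker φ)]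
      apply Submodule.finrank_mono
      rintro _ ⟨a, ha, rfl⟩
      refine ⟨a.2, ?_⟩
      have h : form (a : V → K) (Pi.single v x) = 0 := ha
      rw [hform] at h
      exact (eq_zero_or_eq_iff hx _).2 h
    have := S.finrank_eq
    omega

/-- The elementary minor `S|^v_x` of `S` at `v` with respect to `x ∈ K - {0}`. -/
def minor (S : IsotropicSystem V) (v : V) (x : K) (hx : x ≠ 0) :
    IsotropicSystem {w // w ≠ v} where
  space := minorSpace S.space v x
  isotropic := minorSpace_isotropic S v x
  finrank_eq := minorSpace_finrank S v x hx

end IsotropicSystem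

namespace IsotropicSystem

section Connectivity

variable {V : Type*} [Fintype V]

/-- The connectivity function `c_S(X) = |X| - dim(L|_{⊆ X})`. -/
noncomputable def conn (S : IsotropicSystem V) (X : Set V) : ℤ :=
  (X.ncard : ℤ) - (Module.finrank (ZMod 2) (restrictSub S.space X) : ℤ)

/-- The partition `(X, Y)` of the vertex set is a `k`-separation of `S`. -/
def IsSeparation (S : IsotropicSystem V) (k : ℕ) (X Y : Set V) : Prop :=
  X ∪ Y = Set.univ ∧ Disjoint X Y ∧ k ≤ min X.ncard Y.ncard ∧ S.conn X < k

/-- `S` is `k`-connected: it has no `k'`-separation with `1 ≤ k' < k`. -/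
def IsKConnected (S : IsotropicSystem V) (k : ℕ) : Prop :=
  ∀ k', 1 ≤ k' → k' < k → ¬ ∃ X Y : Set V, S.IsSeparation k' X Y

/-- `v` is non-essential in `S`: at least two of the three elementary minors of `S` at `v` are
`3`-connected. -/
def IsNonessential [DecidableEq V] (S : IsotropicSystem V) (v : V) : Prop :=
  ∃ (x y : K) (hx : x ≠ 0) (hy : y ≠ 0), x ≠ y ∧
    (S.minor v x hx).IsKConnected 3 ∧ (S.minor v y hy).IsKConnected 3

end Connectivity

section Fundamental

variable {V : Type*} [Fintype V]

/-- `a` is an Eulerian vector of `S`: it is complete, and `a[X] ∉ L` for every nonempty `X ⊆ V`. -/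
def IsEulerian (S : IsotropicSystem V) (a : V → K) : Prop :=
  (∀ v, a v ≠ 0) ∧ ∀ X : Set V, X.Nonempty → X.indicator a ∉ S.space

/-- `(b_v)_{v ∈ V}` is the fundamental basis of `S` with respect to the Eulerian vector `a`. -/
def IsFundamentalBasis (S : IsotropicSystem V) (a : V → K) (b : V → V → K) : Prop :=
  ∀ v, b v ∈ S.space ∧ formK (b v v) (a v) = 1 ∧ ∀ w, w ≠ v → formK (b v w) (a w) = 0

/-- `G` is the fundamental graph of `S` with respect to the Eulerian vector `a`. -/
def IsFundamentalGraphWrt (S : IsotropicSystem V) (a : V → K) (G : SimpleGraph V) : Prop :=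
  S.IsEulerian a ∧ ∃ b : V → V → K, S.IsFundamentalBasis a b ∧
    ∀ v w, G.Adj v w ↔ v ≠ w ∧ b v w ≠ 0

/-- `S` is cyclic: it has a cycle graph of length at least `5` as a fundamental graph. -/
def IsCyclic (S : IsotropicSystem V) : Prop :=
  ∃ (a : V → K) (G : SimpleGraph V) (n : ℕ), S.IsFundamentalGraphWrt a G ∧ 5 ≤ n ∧
    Nonempty (G ≃g SimpleGraph.cycleGraph n)

/-- `t` is a triangle in `S`: a vector of `L` whose support has size `3`. -/
def IsTriangleVector (S : IsotropicSystem V) (t : V → K) : Prop :=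
  t ∈ S.space ∧ (Function.support t).ncard = 3

/-- The triangle hypergraph `H(S)` on `V`: its edges are the supports of the triangles in `S`. -/
def triangleHypergraph (S : IsotropicSystem V) : Hypergraph V where
  vertexSet := Set.univ
  edgeSet := {e | ∃ t, S.IsTriangleVector t ∧ e = Function.support t}
  subset_vertexSet_of_mem_edgeSet' := fun _ _ => Set.subset_univ _

theorem triangleHypergraph_isUniform (S : IsotropicSystem V) :
    S.triangleHypergraph.IsUniform 3 := by
  rintro _ ⟨t, ht, rfl⟩
  exact ht.2

end Fundamental

end IsotropicSystem

/-!
The edges of each of the five kinds of partial hypergraphs are edges of `H(S)` by definition, so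
the content is that every triangle lies in one of them. Throughout, an element outside `N` is
called essential.

Two triangles that meet in a single element agree there (`eq_of_meet`), while two triangles with
exactly two common elements disagree at both (`IsTriVec.ne_of_common`). The minor at an element of
a triangle, with respect to the value of that triangle, is not `3`-connected
(`IsTriVec.not_isKConnected_minor`), so the two common elements of two such triangles are
essential. In the other direction there is an analogue of Tutte's triangle lemma
(`Tri.exists_tri`): if `u` and `v` are essential and `{u, v, w}` is a triangle, then a further
triangle contains `u` and exactly one of `v` and `w`. It is proved by uncrossing: if the minor of
`S` at `u` with respect to a value `y` other than that of the triangle is not `3`-connected, then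
`V - u` splits into two sides of connectivity two that separate `v` from `w`, and each side
together with `u` supports a vector of `S` with value `y` at `u` (`exists_isSplit`). Such splits
at `u` and at `v` cross, and submodularity leaves only small cases, in which the required triangle
is visible (`IsSplit.exists_tri`).

A system with five elements is cyclic, as every set of three elements is a triangle. With at least
six elements, values at a common element restrict which triangles meet (`Tri.mem_of_tri`). In
particular the edges through the middle element of a tight path of length three all belong to that
path, unless `S` is cyclic (`eq_of_mem_of_tight_path`). A triangle with no essential element is an
`N`-triangle, and one with exactly one essential element lies in an `N`-windmill. A triangle with
two essential elements lies in a tight path of length two; take one that cannot be extended. If it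
closes up, its connectivity is so small that it contains all of `V`, and `S` is cyclic
(`IsTightSeq.isCyclic_of_closed`). Otherwise a further edge at an internal element can only arise
from a tripod (length two) or a table (length three), and if there is none, then the path is an
ear: its ends are not essential, since the triangle lemma would produce a further edge.
-/

/-! ### Connectivity of isotropic systems -/

namespace IsotropicSystem

section Connectivity

variable {V : Type*} [Fintype V]

theorem finrank_supportedIn_ge (X : Set V) :
    2 * X.ncard ≤ Module.finrank (ZMod 2) (supportedIn X : Submodule (ZMod 2) (V → K)) := by
  classical
  have hrn := LinearMap.finrank_range_add_finrank_ker (proj (V := V) fun w => w ∈ Xᶜ)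
  have hker : LinearMap.ker (proj (V := V) fun w => w ∈ Xᶜ) ≤ supportedIn X := by
    intro a ha w hw
    by_contra hwX
    exact hw (congrFun (LinearMap.mem_ker.1 ha) ⟨w, hwX⟩)
  have h1 := Submodule.finrank_mono hker
  have h2 := Submodule.finrank_le (LinearMap.range (proj (V := V) fun w => w ∈ Xᶜ))
  have h3 : Module.finrank (ZMod 2) (V → K) = Fintype.card V * 2 := by
    rw [Module.finrank_pi_fintype]; simp
  have h4 : Module.finrank (ZMod 2) ({w // w ∈ Xᶜ} → K) = Xᶜ.ncard * 2 := by
    have : Xᶜ.ncard = Fintype.card {w // w ∈ Xᶜ} := by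
      rw [← Nat.card_coe_set_eq, Nat.card_eq_fintype_card]
    rw [Module.finrank_pi_fintype, Finset.sum_const, Finset.card_univ, this,
      Module.finrank_prod, Module.finrank_self, smul_eq_mul]
  have h5 := Set.ncard_add_ncard_compl X
  rw [Nat.card_eq_fintype_card] at h5
  lia

/-- The dimension of the space of vectors of `S` supported in `X`. -/
noncomputable def suppDim (S : IsotropicSystem V) (X : Set V) : ℕ :=
  Module.finrank (ZMod 2) (S.space ⊓ supportedIn X : Submodule (ZMod 2) (V → K))

theorem conn_eq (S : IsotropicSystem V) (X : Set V) :
    S.conn X = (X.ncard : ℤ) - S.suppDim X := by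
  unfold conn suppDim restrictSub
  congr 2
  set f := (proj (V := V) fun w => w ∈ X).domRestrict (S.space ⊓ supportedIn X) with hf
  have hrange : LinearMap.range f =
      (S.space ⊓ supportedIn X).map (proj (V := V) fun w => w ∈ X) := by
    rw [hf, LinearMap.range_domRestrict]
  rw [← hrange]
  apply LinearMap.finrank_range_of_inj
  rw [← LinearMap.ker_eq_bot, eq_bot_iff]
  rintro ⟨a, ha, haX⟩ h
  have h0 : ∀ w ∈ X, a w = 0 := fun w hw => congrFun (LinearMap.mem_ker.1 h) ⟨w, hw⟩
  rw [Submodule.mem_bot]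
  ext1
  funext w
  by_contra hw
  exact hw (h0 w (haX hw))

theorem form_ker_eq_bot : LinearMap.ker (form (V := V)) = ⊥ := by
  classical
  rw [eq_bot_iff]
  intro a ha
  rw [LinearMap.mem_ker] at ha
  rw [Submodule.mem_bot]
  funext v
  have key : ∀ y : K, formK (a v) y = 0 := by
    intro y
    have h : form a (Pi.single v y) = 0 := by rw [ha]; rfl
    rw [form_apply, Finset.sum_eq_single v] at h
    · simpa using h
    · intro w _ hw
      simp [Pi.single_eq_of_ne hw]
    · simp
  have h1 := key (1, 0)
  have h2 := key (0, 1)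
  change (a v).1 * 0 + (a v).2 * 1 = 0 at h1
  change (a v).1 * 1 + (a v).2 * 0 = 0 at h2
  ext
  · simpa using h2
  · simpa using h1

/-- The vectors of `S` and the vectors supported off `X` are both orthogonal to the vectors of `S`
supported in `X`; comparing dimensions bounds `c_S(Xᶜ)`. -/
theorem conn_compl_le (S : IsotropicSystem V) (X : Set V) : S.conn Xᶜ ≤ S.conn X := by
  rw [conn_eq, conn_eq]
  have h := LinearMap.BilinForm.finrank_add_finrank_orthogonal' (B := form (V := V))
    (S.space ⊓ supportedIn X)
  rw [form_ker_eq_bot, inf_bot_eq, finrank_bot, add_zero] at h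
  have hle : S.space ⊔ supportedIn Xᶜ ≤
      LinearMap.BilinForm.orthogonal form (S.space ⊓ supportedIn X) := by
    refine sup_le (fun a ha b hb => S.isotropic b hb.1 a ha) fun a ha b hb => ?_
    change form b a = 0
    rw [form_apply]
    refine Finset.sum_eq_zero fun w _ => ?_
    by_cases hw : b w = 0
    · simp [hw]
    · have : a w = 0 := by
        by_contra haw
        exact ha haw (hb.2 hw)
      simp [this]
  have h1 := Submodule.finrank_mono hle
  have h2 := Submodule.finrank_sup_add_finrank_inf_eq S.space
    (supportedIn Xᶜ : Submodule (ZMod 2) (V → K))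
  have h3 := finrank_supportedIn_ge Xᶜ
  have h4 : Module.finrank (ZMod 2) (V → K) = Fintype.card V * 2 := by
    rw [Module.finrank_pi_fintype]; simp
  have h5 := Set.ncard_add_ncard_compl X
  rw [Nat.card_eq_fintype_card] at h5
  have h6 := S.finrank_eq
  unfold suppDim
  lia

theorem conn_compl (S : IsotropicSystem V) (X : Set V) : S.conn Xᶜ = S.conn X :=
  le_antisymm (S.conn_compl_le X) (by simpa using S.conn_compl_le Xᶜ)

theorem conn_submodular (S : IsotropicSystem V) (X Y : Set V) :
    S.conn (X ∩ Y) + S.conn (X ∪ Y) ≤ S.conn X + S.conn Y := by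
  simp only [conn_eq]
  have h1 := Set.ncard_union_add_ncard_inter X Y
  have h2 := Submodule.finrank_sup_add_finrank_inf_eq
    (S.space ⊓ supportedIn X) (S.space ⊓ supportedIn Y)
  have h3 : (S.space ⊓ supportedIn X) ⊔ (S.space ⊓ supportedIn Y) ≤
      S.space ⊓ supportedIn (X ∪ Y) :=
    sup_le (inf_le_inf_left _ fun a ha => Set.Subset.trans ha Set.subset_union_left)
      (inf_le_inf_left _ fun a ha => Set.Subset.trans ha Set.subset_union_right)
  have h4 : (S.space ⊓ supportedIn X) ⊓ (S.space ⊓ supportedIn Y) ≤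
      S.space ⊓ supportedIn (X ∩ Y) :=
    fun a ha => ⟨ha.1.1, Set.subset_inter ha.1.2 ha.2.2⟩
  have h5 := Submodule.finrank_mono h3
  have h6 := Submodule.finrank_mono h4
  unfold suppDim
  lia

theorem conn_le_ncard (S : IsotropicSystem V) (X : Set V) : S.conn X ≤ X.ncard := by
  rw [conn_eq]; lia

/-- A vector in `X ∪ {u}` that is nonzero at `u` raises the dimension by at least one when `u` is
added to `X`. -/
theorem conn_insert_le (S : IsotropicSystem V) {X : Set V} {u : V} (hu : u ∉ X) {m : V → K}
    (hm : m ∈ S.space) (hmX : Function.support m ⊆ insert u X) (hmu : m u ≠ 0) :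
    S.conn (insert u X) ≤ S.conn X := by
  rw [conn_eq, conn_eq, Set.ncard_insert_of_notMem hu]
  have hlt : S.space ⊓ supportedIn X < S.space ⊓ supportedIn (insert u X) := by
    refine lt_of_le_of_ne (inf_le_inf_left _ fun a ha =>
      Set.Subset.trans ha (Set.subset_insert _ _)) fun h => ?_
    have : m ∈ S.space ⊓ supportedIn X := h ▸ ⟨hm, hmX⟩
    exact hu (this.2 hmu)
  have := Submodule.finrank_lt_finrank_of_lt hlt
  unfold suppDim
  lia

/-- Two vectors in `X ∪ {u}` with distinct nonzero values at `u` raise the dimension by two when `u`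
is added to `X`: the vectors with value `0` or `m u` at `u` form an intermediate space. -/
theorem conn_insert_lt (S : IsotropicSystem V) {X : Set V} {u : V} (hu : u ∉ X) {m m' : V → K}
    (hm : m ∈ S.space) (hmX : Function.support m ⊆ insert u X) (hmu : m u ≠ 0)
    (hm' : m' ∈ S.space) (hmX' : Function.support m' ⊆ insert u X) (hmu' : m' u ≠ 0)
    (hne : m u ≠ m' u) :
    S.conn (insert u X) < S.conn X := by
  rw [conn_eq, conn_eq, Set.ncard_insert_of_notMem hu]
  set M := S.space ⊓ supportedIn (insert u X) ⊓ valueIn u (m u) with hM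
  have hlt : S.space ⊓ supportedIn X < M := by
    refine lt_of_le_of_ne (fun a ha =>
      ⟨⟨ha.1, Set.Subset.trans ha.2 (Set.subset_insert _ _)⟩, Or.inl ?_⟩) fun h => ?_
    · by_contra hau
      exact hu (ha.2 hau)
    have : m ∈ S.space ⊓ supportedIn X := h ▸ ⟨⟨hm, hmX⟩, Or.inr rfl⟩
    exact hu (this.2 hmu)
  have hlt' : M < S.space ⊓ supportedIn (insert u X) := by
    refine lt_of_le_of_ne inf_le_left fun h => ?_
    have : m' ∈ M := h ▸ ⟨hm', hmX'⟩
    rcases this.2 with h | h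
    · exact hmu' h
    · exact hne h.symm
  have h1 := Submodule.finrank_lt_finrank_of_lt hlt
  have h2 := Submodule.finrank_lt_finrank_of_lt hlt'
  unfold suppDim
  lia

/-- A partial converse of `conn_insert_le`. -/
theorem exists_of_conn_insert_le (S : IsotropicSystem V) {X : Set V} {u : V} (hu : u ∉ X)
    (h : S.conn (insert u X) ≤ S.conn X) :
    ∃ m ∈ S.space, Function.support m ⊆ insert u X ∧ m u ≠ 0 := by
  by_contra! hno
  rw [conn_eq, conn_eq, Set.ncard_insert_of_notMem hu] at h
  have hle : S.space ⊓ supportedIn (insert u X) ≤ S.space ⊓ supportedIn X := by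
    intro a ha
    refine ⟨ha.1, fun w hw => ?_⟩
    rcases ha.2 hw with rfl | h
    · exact absurd (hno a ha.1 ha.2) hw
    · exact h
  have := Submodule.finrank_mono hle
  unfold suppDim at h
  lia

/-- A nonzero vector supported in `X`, unless `c_S(X) = |X|`. -/
theorem exists_of_conn_lt (S : IsotropicSystem V) {X : Set V} (h : S.conn X < X.ncard) :
    ∃ m ∈ S.space, Function.support m ⊆ X ∧ m ≠ 0 := by
  rw [conn_eq] at h
  have hne : S.space ⊓ supportedIn X ≠ ⊥ := by
    intro h0
    unfold suppDim at h
    rw [h0, finrank_bot] at h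
    simp at h
  obtain ⟨m, hm, hm0⟩ := Submodule.exists_mem_ne_zero_of_ne_bot hne
  exact ⟨m, hm.1, hm.2, hm0⟩

theorem conn_lt_of_mem (S : IsotropicSystem V) {X : Set V} {m : V → K} (hm : m ∈ S.space)
    (hmX : Function.support m ⊆ X) (h0 : m ≠ 0) : S.conn X < X.ncard := by
  rw [conn_eq]
  have : 0 < S.suppDim X := by
    unfold suppDim
    rw [Module.finrank_pos_iff_exists_ne_zero]
    exact ⟨⟨m, hm, hmX⟩, fun h => h0 (congrArg Subtype.val h)⟩
  lia

theorem formK_eq_zero_of_meet (S : IsotropicSystem V) {m m' : V → K} (hm : m ∈ S.space)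
    (hm' : m' ∈ S.space) {x : V} (h : ∀ w, w ≠ x → formK (m w) (m' w) = 0) :
    formK (m x) (m' x) = 0 := by
  have h1 := S.isotropic m hm m' hm'
  rwa [form_apply, Finset.sum_eq_single x (fun w _ hw => h w hw) (by simp)] at h1

theorem eq_of_formK_eq_zero {x y : K} (hx : x ≠ 0) (hy : y ≠ 0) (h : formK x y = 0) : x = y := by
  by_contra hne
  rw [(formK_eq_one_iff x y).2 ⟨hx, hne, hy⟩] at h
  exact one_ne_zero h

/-- Two vectors of `S` whose supports meet only at `x` agree at `x`. -/
theorem eq_of_meet (S : IsotropicSystem V) {m m' : V → K} (hm : m ∈ S.space)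
    (hm' : m' ∈ S.space) {x : V} (h : ∀ w, w ≠ x → m w = 0 ∨ m' w = 0) (hx : m x ≠ 0)
    (hx' : m' x ≠ 0) : m x = m' x := by
  refine eq_of_formK_eq_zero hx hx' (S.formK_eq_zero_of_meet hm hm' fun w hw => ?_)
  rcases h w hw with h | h <;> simp [h]

end Connectivity

section ThreeConnected

variable {V : Type*} [Fintype V] {S : IsotropicSystem V}

theorem IsKConnected.two_le_conn (hS : S.IsKConnected 3) {X : Set V} (h1 : 2 ≤ X.ncard)
    (h2 : 2 ≤ Xᶜ.ncard) : 2 ≤ S.conn X := by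
  by_contra h
  exact hS 2 (by lia) (by lia) ⟨X, Xᶜ, Set.union_compl_self X, disjoint_compl_right,
    le_min h1 h2, by push_cast; lia⟩

/-- Every nonzero vector of a `3`-connected system has at least three nonzero entries, as a pair of
elements has connectivity two. -/
theorem IsKConnected.three_le_ncard_support (hS : S.IsKConnected 3)
    (hV : 4 ≤ Fintype.card V) {m : V → K} (hm : m ∈ S.space) (h0 : m ≠ 0) :
    3 ≤ (Function.support m).ncard := by
  by_contra h
  obtain ⟨X, hX, hX2⟩ := Set.exists_superset_subset_encard_eq (s := Function.support m)
    (t := Set.univ) (k := 2) (Set.subset_univ _)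
    (by rw [← Set.Finite.cast_ncard_eq (Set.toFinite _)]; exact_mod_cast (by lia))
    (by rw [← Set.Finite.cast_ncard_eq (Set.toFinite _), Set.ncard_univ,
          Nat.card_eq_fintype_card]; exact_mod_cast (by lia))
  have hX3 : X.ncard = 2 := by rw [Set.ncard, hX2.2]; rfl
  have h5 := Set.ncard_add_ncard_compl X
  rw [Nat.card_eq_fintype_card] at h5
  have h6 := hS.two_le_conn (X := X) (by lia) (by lia)
  have h7 := S.conn_lt_of_mem hm hX h0
  lia

end ThreeConnected

end IsotropicSystem

/-! ### Triangles and the triangle lemma -/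

namespace IsotropicSystem

theorem ncard_pair_le {α : Type*} (a b : α) : ({a, b} : Set α).ncard ≤ 2 :=
  (Set.ncard_insert_le _ _).trans (by simp)

theorem two_le_ncard_of_mem {α : Type*} [Finite α] {X : Set α} {a b : α} (ha : a ∈ X)
    (hb : b ∈ X) (h : a ≠ b) : 2 ≤ X.ncard := by
  rw [← Set.ncard_pair h]
  exact Set.ncard_le_ncard (Set.insert_subset ha (Set.singleton_subset_iff.2 hb))

section Triangles

variable {V : Type*} [Fintype V]

/-- `t` is a vector of `S` whose support consists of the three distinct elements `a`, `b`, `c`. -/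
structure IsTriVec (S : IsotropicSystem V) (t : V → K) (a b c : V) : Prop where
  mem : t ∈ S.space
  ne_ab : a ≠ b
  ne_ac : a ≠ c
  ne_bc : b ≠ c
  ne_zero_iff : ∀ w, t w ≠ 0 ↔ w = a ∨ w = b ∨ w = c

/-- `a`, `b`, `c` are distinct and `{a, b, c}` is the support of a vector of `S`. -/
def Tri (S : IsotropicSystem V) (a b c : V) : Prop := ∃ t, S.IsTriVec t a b c

variable {S : IsotropicSystem V} {t t' m : V → K} {a b c u v w x y p q r s : V}

namespace IsTriVec

theorem rotate (h : S.IsTriVec t a b c) : S.IsTriVec t b c a :=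
  ⟨h.mem, h.ne_bc, h.ne_ab.symm, h.ne_ac.symm, fun w => (h.ne_zero_iff w).trans (by tauto)⟩

theorem swap (h : S.IsTriVec t a b c) : S.IsTriVec t a c b :=
  ⟨h.mem, h.ne_ac, h.ne_ab, h.ne_bc.symm, fun w => (h.ne_zero_iff w).trans (by tauto)⟩

theorem ne₁ (h : S.IsTriVec t a b c) : t a ≠ 0 := (h.ne_zero_iff a).2 (by simp)

theorem ne₂ (h : S.IsTriVec t a b c) : t b ≠ 0 := (h.ne_zero_iff b).2 (by simp)

theorem ne₃ (h : S.IsTriVec t a b c) : t c ≠ 0 := (h.ne_zero_iff c).2 (by simp)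

theorem eq_zero (h : S.IsTriVec t a b c) (ha : w ≠ a) (hb : w ≠ b) (hc : w ≠ c) : t w = 0 := by
  by_contra hw
  rcases (h.ne_zero_iff w).1 hw with h | h | h <;> contradiction

theorem support_eq (h : S.IsTriVec t a b c) : Function.support t = {a, b, c} := by
  ext w
  simpa using h.ne_zero_iff w

theorem ncard_support (h : S.IsTriVec t a b c) : (Function.support t).ncard = 3 := by
  rw [h.support_eq, Set.ncard_eq_three]
  exact ⟨a, b, c, h.ne_ab, h.ne_ac, h.ne_bc, rfl⟩

end IsTriVec

theorem Tri.rotate (h : S.Tri a b c) : S.Tri b c a := h.imp fun _ => IsTriVec.rotate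

theorem Tri.swap (h : S.Tri a b c) : S.Tri a c b := h.imp fun _ => IsTriVec.swap

theorem Tri.swap₁₂ (h : S.Tri a b c) : S.Tri b a c := h.rotate.swap

theorem Tri.reverse (h : S.Tri a b c) : S.Tri c b a := h.rotate.swap₁₂

theorem Tri.ne_ab (h : S.Tri a b c) : a ≠ b := h.choose_spec.ne_ab

theorem Tri.ne_ac (h : S.Tri a b c) : a ≠ c := h.choose_spec.ne_ac

theorem Tri.ne_bc (h : S.Tri a b c) : b ≠ c := h.choose_spec.ne_bc

theorem isTriVec_of_support_subset (hS : S.IsKConnected 3) (hV : 4 ≤ Fintype.card V)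
    (hm : m ∈ S.space) (h0 : m ≠ 0) (hsupp : Function.support m ⊆ {a, b, c}) :
    S.IsTriVec m a b c := by
  have h3 := hS.three_le_ncard_support hV hm h0
  have h4 : ({a, b, c} : Set V).ncard ≤ 3 := by
    refine (Set.ncard_insert_le _ _).trans ?_
    have := ncard_pair_le b c
    lia
  have heq := Set.eq_of_subset_of_ncard_le hsupp (by lia)
  rw [heq] at h3
  refine ⟨hm, ?_, ?_, ?_, fun w => ?_⟩
  · rintro rfl
    have := ncard_pair_le a c
    simp at h3
    lia
  · rintro rfl
    have := ncard_pair_le b a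
    rw [Set.insert_comm] at h3
    simp at h3
    lia
  · rintro rfl
    have := ncard_pair_le a b
    simp at h3
    lia
  · rw [← Function.mem_support, heq]; simp

theorem tri_of_conn_le (hS : S.IsKConnected 3) (hV : 4 ≤ Fintype.card V) (hab : a ≠ b)
    (hac : a ≠ c) (hbc : b ≠ c) (h : S.conn {a, b, c} ≤ 2) : S.Tri a b c := by
  have h3 : ({a, b, c} : Set V).ncard = 3 := Set.ncard_eq_three.2 ⟨a, b, c, hab, hac, hbc, rfl⟩
  obtain ⟨m, hm, hmX, h0⟩ := S.exists_of_conn_lt (X := {a, b, c}) (by lia)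
  exact ⟨m, isTriVec_of_support_subset hS hV hm h0 hmX⟩

theorem form_eq_zero_two (hm : t ∈ S.space) (hm' : t' ∈ S.space) (hab : a ≠ b)
    (h : ∀ w, w ≠ a → w ≠ b → t w = 0 ∨ t' w = 0) :
    formK (t a) (t' a) + formK (t b) (t' b) = 0 := by
  have h1 := S.isotropic t hm t' hm'
  rwa [form_apply, Fintype.sum_eq_add a b hab] at h1
  rintro w ⟨hwa, hwb⟩
  rcases h w hwa hwb with h | h <;> simp [h]

theorem form_eq_zero_three (hm : t ∈ S.space) (hm' : t' ∈ S.space) (hab : a ≠ b) (hac : a ≠ c)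
    (hbc : b ≠ c) (h : ∀ w, w ≠ a → w ≠ b → w ≠ c → t w = 0 ∨ t' w = 0) :
    formK (t a) (t' a) + (formK (t b) (t' b) + formK (t c) (t' c)) = 0 := by
  classical
  have h1 := S.isotropic t hm t' hm'
  rw [form_apply, ← Finset.sum_subset (Finset.subset_univ {a, b, c})] at h1
  · rwa [Finset.sum_insert (by simp [hab, hac]), Finset.sum_pair hbc] at h1
  · intro w _ hw
    simp only [Finset.mem_insert, Finset.mem_singleton, not_or] at hw
    rcases h w hw.1 hw.2.1 hw.2.2 with h | h <;> simp [h]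

theorem formK_eq_one {x y : K} (hx : x ≠ 0) (hy : y ≠ 0) (h : x ≠ y) : formK x y = 1 :=
  (formK_eq_one_iff x y).2 ⟨hx, h, hy⟩

theorem eq_one_of_one_add {z : ZMod 2} (h : 1 + z = 0) : z = 1 := by
  revert z; decide

/-- Two triangles with exactly two common elements disagree there: otherwise their sum would have
support of size at most two. -/
theorem IsTriVec.ne_of_common (hS : S.IsKConnected 3) (hV : 4 ≤ Fintype.card V)
    (h : S.IsTriVec t x y p) (h' : S.IsTriVec t' x y q) (hpq : p ≠ q) : t x ≠ t' x := by
  intro hx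
  have hy : formK (t x) (t' x) + formK (t y) (t' y) = 0 :=
    form_eq_zero_two h.mem h'.mem h.ne_ab fun w hwx hwy => by
      by_cases hwp : w = p
      · exact Or.inr (h'.eq_zero hwx hwy (hwp ▸ hpq))
      · exact Or.inl (h.eq_zero hwx hwy hwp)
  rw [formK_eq_zero_of_mem (x := t' x) (Or.inr hx) (Or.inr rfl), zero_add] at hy
  have hy' := eq_of_formK_eq_zero h.ne₂ h'.ne₂ hy
  have hadd : ∀ z : K, z + z = 0 := by decide
  have hp : (t + t') p ≠ 0 := by
    rw [Pi.add_apply, h'.eq_zero h.ne_ac.symm h.ne_bc.symm hpq, add_zero]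
    exact h.ne₃
  have h3 := hS.three_le_ncard_support hV (S.space.add_mem h.mem h'.mem)
    (fun h0 => hp (congrFun h0 p))
  have hsub : Function.support (t + t') ⊆ {p, q} := by
    intro w hw
    by_contra hwpq
    simp only [Set.mem_insert_iff, Set.mem_singleton_iff, not_or] at hwpq
    apply hw
    rw [Pi.add_apply]
    by_cases hwx : w = x
    · rw [hwx, hx, hadd]
    by_cases hwy : w = y
    · rw [hwy, hy', hadd]
    rw [h.eq_zero hwx hwy hwpq.1, h'.eq_zero hwx hwy hwpq.2, add_zero]
  have := Set.ncard_le_ncard hsub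
  have := ncard_pair_le p q
  lia

/-- A partition `(A, B)` of `V - u` that is a `2`-separation of the minor at `u` with respect to
`y`, expressed in `S`: both sides have connectivity at most `2`, and each side together with `u`
supports a vector with value `y` at `u`. -/
structure IsSplit (S : IsotropicSystem V) (u : V) (y : K) (A B : Set V) : Prop where
  notMem_left : u ∉ A
  notMem_right : u ∉ B
  cover : ∀ w, w ≠ u → w ∈ A ∨ w ∈ B
  disj : Disjoint A B
  two_le_left : 2 ≤ A.ncard
  two_le_right : 2 ≤ B.ncard
  conn_left : S.conn A ≤ 2
  conn_right : S.conn B ≤ 2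
  exists_left : ∃ m ∈ S.space, Function.support m ⊆ insert u A ∧ m u = y
  exists_right : ∃ m ∈ S.space, Function.support m ⊆ insert u B ∧ m u = y

namespace IsSplit

variable {y : K} {A B : Set V}

theorem symm (h : S.IsSplit u y A B) : S.IsSplit u y B A :=
  ⟨h.notMem_right, h.notMem_left, fun w hw => (h.cover w hw).symm, h.disj.symm, h.two_le_right,
    h.two_le_left, h.conn_right, h.conn_left, h.exists_right, h.exists_left⟩

theorem notMem_of_mem (h : S.IsSplit u y A B) (hw : w ∈ A) : w ∉ B :=
  Set.disjoint_left.1 h.disj hw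

theorem compl_left (h : S.IsSplit u y A B) : Aᶜ = insert u B := by
  ext w
  simp only [Set.mem_compl_iff, Set.mem_insert_iff]
  constructor
  · intro hw
    by_cases hwu : w = u
    · exact Or.inl hwu
    · exact Or.inr ((h.cover w hwu).resolve_left hw)
  · rintro (rfl | hw)
    · exact h.notMem_left
    · exact h.symm.notMem_of_mem hw

theorem conn_insert_right (h : S.IsSplit u y A B) : S.conn (insert u B) ≤ 2 := by
  rw [← h.compl_left, conn_compl]
  exact h.conn_left

theorem conn_insert_left (h : S.IsSplit u y A B) : S.conn (insert u A) ≤ 2 :=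
  h.symm.conn_insert_right

/-- Since the side `B` contributes the value `y` at `u`, isotropy allows no other nonzero value from
the side `A`. -/
theorem value_left (h : S.IsSplit u y A B) (hy : y ≠ 0) (hm : m ∈ S.space)
    (hmA : Function.support m ⊆ insert u A) (hmu : m u ≠ 0) : m u = y := by
  obtain ⟨m', hm', hmB, hmu'⟩ := h.exists_right
  rw [← hmu']
  refine S.eq_of_meet hm hm' (fun w hw => ?_) hmu (hmu' ▸ hy)
  by_contra! hne
  exact h.notMem_of_mem ((hmA hne.1).resolve_left hw) ((hmB hne.2).resolve_left hw)

/-- A triangle with a value other than `y` at `u` has its other two elements on different sides. -/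
theorem mem_right_of_tri (h : S.IsSplit u y A B) (hy : y ≠ 0) (ht : S.IsTriVec t u v w)
    (hty : t u ≠ y) (hv : v ∈ A) : w ∈ B := by
  refine (h.cover w ht.ne_ac.symm).resolve_left fun hw => hty ?_
  refine h.value_left hy ht.mem ?_ ht.ne₁
  rw [ht.support_eq]
  exact Set.insert_subset_insert (Set.insert_subset hv (Set.singleton_subset_iff.2 hw))

/-- A side with two elements forms a triangle with `u`. -/
theorem tri_of_ncard_eq_two (h : S.IsSplit u y A B) (hy : y ≠ 0) (hS : S.IsKConnected 3)
    (hV : 4 ≤ Fintype.card V) (hv : v ∈ A) (h2 : A.ncard = 2) : ∃ p ∈ A, S.Tri u v p := by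
  obtain ⟨m, hm, hmA, hmu⟩ := h.exists_left
  obtain ⟨a, b, hab, rfl⟩ := Set.ncard_eq_two.1 h2
  have ht := isTriVec_of_support_subset hS hV hm (fun h0 => hy (by rw [← hmu, h0]; rfl)) hmA
  rcases hv with rfl | hv
  · exact ⟨b, by simp, m, ht⟩
  · obtain rfl : v = b := hv
    exact ⟨a, by simp, m, ht.swap⟩

theorem ncard_eq_of_mem (h : S.IsSplit u y A B) {X : Set V} (hu : u ∈ X) :
    X.ncard = (X ∩ A).ncard + (X ∩ B).ncard + 1 := by
  have h1 := Set.ncard_inter_add_ncard_sdiff_eq_ncard X A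
  have h2 : X \ A = insert u (X ∩ B) := by
    rw [Set.sdiff_eq, h.compl_left, Set.inter_insert_of_mem hu]
  rw [h2, Set.ncard_insert_of_notMem (fun hh => h.notMem_right hh.2)] at h1
  lia

theorem ncard_eq_of_notMem (h : S.IsSplit u y A B) {X : Set V} (hu : u ∉ X) :
    X.ncard = (X ∩ A).ncard + (X ∩ B).ncard := by
  have h1 := Set.ncard_inter_add_ncard_sdiff_eq_ncard X A
  have h2 : X \ A = X ∩ B := by
    rw [Set.sdiff_eq, h.compl_left, Set.inter_insert_of_notMem hu]
  rw [h2] at h1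
  lia

variable {y' : K} {C D : Set V}

/-- Two splits, at two elements of a triangle, that cross in the corners `A ∩ D` and `B ∩ C`. If
the first is nonempty and the second has two elements, then uncrossing yields a vector in
`(B ∩ C) ∪ {u}` that is nonzero at `u`. Its value there is `y` because of the split, but it is `t u`
because the vector meets the triangle only in `u`. -/
theorem ncard_inter_le_one (h : S.IsSplit u y A B) (h' : S.IsSplit v y' C D) (hy : y ≠ 0)
    (hS : S.IsKConnected 3) (ht : S.IsTriVec t u v w) (hty : t u ≠ y)
    (hv : v ∈ A) (hu : u ∈ C) (hwB : w ∈ B) (hwD : w ∈ D) (hne : (A ∩ D).Nonempty) :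
    (B ∩ C).ncard ≤ 1 := by
  by_contra hBC
  obtain ⟨q, hqA, hqD⟩ := hne
  have hvq : v ≠ q := fun e => h'.notMem_right (e ▸ hqD)
  have hsub := S.conn_submodular A (insert v D)
  have h1 : 2 ≤ S.conn (A ∩ insert v D) := by
    refine hS.two_le_conn (two_le_ncard_of_mem (a := v) (b := q) ⟨hv, Or.inl rfl⟩
      ⟨hqA, Or.inr hqD⟩ hvq) (two_le_ncard_of_mem (a := u) (b := w) ?_ ?_ ht.ne_ac)
    · exact fun hh => h.notMem_left hh.1
    · exact fun hh => h.notMem_of_mem hh.1 hwB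
  have h2 : A ∪ insert v D = (insert u (B ∩ C))ᶜ := by
    ext z
    have e1 := h.cover z
    have e2 := h'.cover z
    have e3 := h.notMem_of_mem (w := z)
    have e4 := h'.notMem_of_mem (w := z)
    simp only [Set.mem_union, Set.mem_insert_iff, Set.mem_compl_iff, Set.mem_inter_iff]
    have e5 : z = u → z ∉ A ∧ z ∈ C := by rintro rfl; exact ⟨h.notMem_left, hu⟩
    have e6 : z = v → z ∈ A := by rintro rfl; exact hv
    tauto
  rw [h2, conn_compl] at hsub
  have h3 := h.conn_left
  have h4 := h'.conn_insert_right
  have h5 : 2 ≤ S.conn (B ∩ C) := by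
    refine hS.two_le_conn (by lia) (two_le_ncard_of_mem (a := u) (b := v) ?_ ?_ ht.ne_ab)
    · exact fun hh => h.notMem_right hh.1
    · exact fun hh => h'.notMem_left hh.2
  obtain ⟨m, hm, hmX, hmu⟩ := S.exists_of_conn_insert_le (X := B ∩ C) (u := u)
    (fun hh => h.notMem_right hh.1) (by lia)
  have hval := h.symm.value_left hy hm
    (hmX.trans (Set.insert_subset_insert Set.inter_subset_left)) hmu
  refine hty ?_
  rw [← hval]
  refine S.eq_of_meet ht.mem hm (fun z hz => ?_) ht.ne₁ hmu
  by_contra! hne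
  have hz' := (hmX hne.2).resolve_left hz
  rcases (ht.ne_zero_iff z).1 hne.1 with rfl | rfl | rfl
  · exact hz rfl
  · exact h'.notMem_left hz'.2
  · exact h'.notMem_of_mem hz'.2 hwD

/-- The argument of `ncard_inter_le_one` for the corners `A ∩ C` and `B ∩ D`. -/
theorem ncard_inter_le_one' (h : S.IsSplit u y A B) (h' : S.IsSplit v y' C D) (hy : y ≠ 0)
    (hS : S.IsKConnected 3) (ht : S.IsTriVec t u v w) (hty : t u ≠ y)
    (hv : v ∈ A) (hu : u ∈ C) (hwB : w ∈ B) (hBD : 2 ≤ (B ∩ D).ncard) :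
    (A ∩ C).ncard ≤ 1 := by
  by_contra hAC
  have hsub := S.conn_submodular (insert u A) C
  rw [Set.insert_inter_of_mem hu] at hsub
  have h2 : insert u A ∪ C = (B ∩ D)ᶜ := by
    ext z
    have e1 := h.cover z
    have e2 := h'.cover z
    have e3 := h.notMem_of_mem (w := z)
    have e4 := h'.notMem_of_mem (w := z)
    simp only [Set.mem_union, Set.mem_insert_iff, Set.mem_compl_iff, Set.mem_inter_iff]
    have e5 : z = u → z ∉ B ∧ z ∈ C := by rintro rfl; exact ⟨h.notMem_right, hu⟩
    have e6 : z = v → z ∈ A := by rintro rfl; exact hv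
    tauto
  rw [h2, conn_compl] at hsub
  have h1 : 2 ≤ S.conn (B ∩ D) := by
    refine hS.two_le_conn hBD (two_le_ncard_of_mem (a := u) (b := v) ?_ ?_ ht.ne_ab)
    · exact fun hh => h.notMem_right hh.1
    · exact fun hh => h'.notMem_right hh.2
  have h3 := h.conn_insert_left
  have h4 := h'.conn_left
  have h5 : 2 ≤ S.conn (A ∩ C) := by
    refine hS.two_le_conn (by lia) (two_le_ncard_of_mem (a := u) (b := v) ?_ ?_ ht.ne_ab)
    · exact fun hh => h.notMem_left hh.1
    · exact fun hh => h'.notMem_left hh.2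
  obtain ⟨m, hm, hmX, hmu⟩ := S.exists_of_conn_insert_le (X := A ∩ C) (u := u)
    (fun hh => h.notMem_left hh.1) (by lia)
  have hval := h.value_left hy hm
    (hmX.trans (Set.insert_subset_insert Set.inter_subset_left)) hmu
  refine hty ?_
  rw [← hval]
  refine S.eq_of_meet ht.mem hm (fun z hz => ?_) ht.ne₁ hmu
  by_contra! hne
  have hz' := (hmX hne.2).resolve_left hz
  rcases (ht.ne_zero_iff z).1 hne.1 with rfl | rfl | rfl
  · exact hz rfl
  · exact h'.notMem_left hz'.2
  · exact h.notMem_of_mem hz'.1 hwB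

/-- The smallest crossing: `A = {v, r, q}` and `C = {u, r, p}` are triangles, and together with the
vector of `A ∪ {u}` that witnesses the split at `u` they produce the triangle `{u, v, r}`. -/
theorem tri_of_small (h : S.IsSplit u y A B) (h' : S.IsSplit v y' C D) (hy : y ≠ 0)
    (hS : S.IsKConnected 3) (hV : 4 ≤ Fintype.card V) (ht : S.IsTriVec t u v w) (hty : t u ≠ y)
    (hv : v ∈ A) (hu : u ∈ C) (hwB : w ∈ B) (hwD : w ∈ D) (hAC : (A ∩ C).ncard = 1)
    (hAD : (A ∩ D).ncard = 1) (hBC : (B ∩ C).ncard = 1) : ∃ p ∈ A, S.Tri u v p := by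
  obtain ⟨r, hr⟩ := Set.ncard_eq_one.1 hAC
  obtain ⟨q, hq⟩ := Set.ncard_eq_one.1 hAD
  obtain ⟨p, hp⟩ := Set.ncard_eq_one.1 hBC
  have hA : A = {v, r, q} := by
    ext z
    have e2 := h'.cover z
    have e3 : z ∈ A ∩ C ↔ z = r := by rw [hr]; rfl
    have e4 : z ∈ A ∩ D ↔ z = q := by rw [hq]; rfl
    simp only [Set.mem_inter_iff] at e3 e4
    have e6 : z = v → z ∈ A := by rintro rfl; exact hv
    simp only [Set.mem_insert_iff, Set.mem_singleton_iff]
    tauto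
  have hC : C = {u, r, p} := by
    ext z
    have e2 := h.cover z
    have e3 : z ∈ A ∩ C ↔ z = r := by rw [hr]; rfl
    have e4 : z ∈ B ∩ C ↔ z = p := by rw [hp]; rfl
    simp only [Set.mem_inter_iff] at e3 e4
    have e6 : z = u → z ∈ C := by rintro rfl; exact hu
    simp only [Set.mem_insert_iff, Set.mem_singleton_iff]
    tauto
  have hr' : r ∈ A ∩ C := hr ▸ rfl
  have hq' : q ∈ A ∩ D := hq ▸ rfl
  have hp' : p ∈ B ∩ C := hp ▸ rfl
  have hvr : v ≠ r := fun e => h'.notMem_left (e ▸ hr'.2)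
  have hvq : v ≠ q := fun e => h'.notMem_right (e ▸ hq'.2)
  have hur : u ≠ r := fun e => h.notMem_left (e ▸ hr'.1)
  have huq : u ≠ q := fun e => h.notMem_left (e ▸ hq'.1)
  have hup : u ≠ p := fun e => h.notMem_right (e ▸ hp'.1)
  have hrq : r ≠ q := fun e => h'.notMem_of_mem hr'.2 (e ▸ hq'.2)
  have hrp : r ≠ p := fun e => h.notMem_of_mem hr'.1 (e ▸ hp'.1)
  have hqp : q ≠ p := fun e => h.notMem_of_mem hq'.1 (e ▸ hp'.1)
  have hvp : v ≠ p := fun e => h.notMem_of_mem hv (e ▸ hp'.1)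
  have hwr : w ≠ r := fun e => h.notMem_of_mem hr'.1 (e ▸ hwB)
  have hwq : w ≠ q := fun e => h.notMem_of_mem hq'.1 (e ▸ hwB)
  have hwp : w ≠ p := fun e => h'.notMem_of_mem hp'.2 (e ▸ hwD)
  obtain ⟨tA, htA⟩ := tri_of_conn_le hS hV hvr hvq hrq (hA ▸ h.conn_left)
  obtain ⟨tC, htC⟩ := tri_of_conn_le hS hV hur hup hrp (hC ▸ h'.conn_left)
  obtain ⟨m, hm, hmA, hmu⟩ := h.exists_left
  have hmz : ∀ z, z ≠ u → z ≠ v → z ≠ r → z ≠ q → m z = 0 := by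
    intro z h1 h2 h3 h4
    by_contra hz
    have := hmA hz
    rw [hA] at this
    simp [h1, h2, h3, h4] at this
  have eA : tA v = t v := S.eq_of_meet htA.mem ht.mem (fun z hz => by
    by_cases hzr : z = r
    · subst hzr; exact Or.inr (ht.eq_zero hur.symm hvr.symm hwr.symm)
    by_cases hzq : z = q
    · subst hzq; exact Or.inr (ht.eq_zero huq.symm hvq.symm hwq.symm)
    exact Or.inl (htA.eq_zero hz hzr hzq)) htA.ne₁ ht.ne₂
  have eC : tC u = t u := S.eq_of_meet htC.mem ht.mem (fun z hz => by
    by_cases hzr : z = r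
    · subst hzr; exact Or.inr (ht.eq_zero hur.symm hvr.symm hwr.symm)
    by_cases hzp : z = p
    · subst hzp; exact Or.inr (ht.eq_zero hup.symm hvp.symm hwp.symm)
    exact Or.inl (htC.eq_zero hz hzr hzp)) htC.ne₁ ht.ne₁
  have eAC : tA r = tC r := S.eq_of_meet htA.mem htC.mem (fun z hz => by
    by_cases hzv : z = v
    · subst hzv; exact Or.inr (htC.eq_zero ht.ne_ab.symm hz hvp)
    by_cases hzq : z = q
    · subst hzq; exact Or.inr (htC.eq_zero huq.symm hz hqp)
    exact Or.inl (htA.eq_zero hzv hz hzq)) htA.ne₂ htC.ne₂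
  have hmu0 : m u ≠ 0 := hmu ▸ hy
  have hone : formK (m u) (t u) = 1 := formK_eq_one hmu0 ht.ne₁ (hmu ▸ hty.symm)
  -- `m` is orthogonal to the triangles `t`, `tC` and `tA`; the last gives `m q = 0` or `m q = tA q`
  have f1 : formK (m v) (t v) = 1 := by
    have := form_eq_zero_two hm ht.mem ht.ne_ab fun z h1 h2 => by
      by_cases hzw : z = w
      · subst hzw; exact Or.inl (hmz z h1 h2 hwr hwq)
      · exact Or.inr (ht.eq_zero h1 h2 hzw)
    rw [hone] at this
    exact eq_one_of_one_add this
  have f2 : formK (m r) (tC r) = 1 := by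
    have := form_eq_zero_two hm htC.mem hur fun z h1 h2 => by
      by_cases hzp : z = p
      · subst hzp; exact Or.inl (hmz z h1 hvp.symm h2 hqp.symm)
      · exact Or.inr (htC.eq_zero h1 h2 hzp)
    rw [eC, hone] at this
    exact eq_one_of_one_add this
  have f3 : formK (m q) (tA q) = 0 := by
    have := form_eq_zero_three hm htA.mem hvr hvq hrq fun z h1 h2 h3 =>
      Or.inr (htA.eq_zero h1 h2 h3)
    rw [eA, f1, eAC, f2, ← add_assoc] at this
    simpa [show (1 : ZMod 2) + 1 = 0 from rfl] using this
  refine ⟨r, hr'.1, ?_⟩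
  rcases (eq_zero_or_eq_iff htA.ne₃ (m q)).2 f3 with h0 | h0
  · refine ⟨m, isTriVec_of_support_subset hS hV hm (fun e => hmu0 (congrFun e u)) fun z hz => ?_⟩
    by_contra hz'
    simp only [Set.mem_insert_iff, Set.mem_singleton_iff, not_or] at hz'
    by_cases hzq : z = q
    · exact hz (hzq ▸ h0)
    · exact hz (hmz z hz'.1 hz'.2.1 hz'.2.2 hzq)
  · have hu0 : tA u = 0 := htA.eq_zero ht.ne_ab hur huq
    refine ⟨m + tA, isTriVec_of_support_subset hS hV (S.space.add_mem hm htA.mem)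
      (fun e => hmu0 (by simpa [hu0] using congrFun e u)) fun z hz => ?_⟩
    by_contra hz'
    simp only [Set.mem_insert_iff, Set.mem_singleton_iff, not_or] at hz'
    apply hz
    rw [Pi.add_apply]
    by_cases hzq : z = q
    · have hadd : ∀ z : K, z + z = 0 := by decide
      rw [hzq, h0, hadd]
    · rw [hmz z hz'.1 hz'.2.1 hz'.2.2 hzq, htA.eq_zero hz'.2.1 hz'.2.2 hzq, add_zero]

/-- Splits at two elements `u`, `v` of a triangle `{u, v, w}` force another triangle that contains
`u` and exactly one of `v` and `w`. -/
theorem exists_tri (h : S.IsSplit u y A B) (h' : S.IsSplit v y' C D) (hy : y ≠ 0) (hy' : y' ≠ 0)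
    (hS : S.IsKConnected 3) (hV : 4 ≤ Fintype.card V) (ht : S.IsTriVec t u v w) (hty : t u ≠ y)
    (hty' : t v ≠ y') (hv : v ∈ A) (hu : u ∈ C) :
    (∃ p, p ≠ w ∧ S.Tri u v p) ∨ ∃ p, p ≠ v ∧ S.Tri u w p := by
  have hwB : w ∈ B := h.mem_right_of_tri hy ht hty hv
  have hwD : w ∈ D := h'.mem_right_of_tri hy' ht.rotate.swap hty' hu
  by_cases hA2 : A.ncard = 2
  · obtain ⟨p, hpA, hp⟩ := h.tri_of_ncard_eq_two hy hS hV hv hA2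
    exact Or.inl ⟨p, fun e => h.notMem_of_mem hpA (e ▸ hwB), hp⟩
  by_cases hB2 : B.ncard = 2
  · obtain ⟨p, hpB, hp⟩ := h.symm.tri_of_ncard_eq_two hy hS hV hwB hB2
    exact Or.inr ⟨p, fun e => h.notMem_of_mem hv (e ▸ hpB), hp⟩
  by_cases hC2 : C.ncard = 2
  · obtain ⟨p, hpC, hp⟩ := h'.tri_of_ncard_eq_two hy' hS hV hu hC2
    exact Or.inl ⟨p, fun e => h'.notMem_of_mem hpC (e ▸ hwD), hp.swap₁₂⟩
  -- with at least three elements in each of `A`, `B` and `C`, the uncrossing bounds leave one case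
  have nA := h'.ncard_eq_of_mem hv
  have nB := h'.ncard_eq_of_notMem (h.notMem_of_mem hv)
  have nC := h.ncard_eq_of_mem hu
  have nD := h.ncard_eq_of_notMem (h'.notMem_of_mem hu)
  rw [Set.inter_comm C A, Set.inter_comm C B] at nC
  rw [Set.inter_comm D A, Set.inter_comm D B] at nD
  have n1 := h.two_le_left
  have n2 := h.two_le_right
  have n3 := h'.two_le_left
  have n4 := h'.two_le_right
  have c1 : 1 ≤ (A ∩ D).ncard → (B ∩ C).ncard ≤ 1 := fun hn =>
    h.ncard_inter_le_one h' hy hS ht hty hv hu hwB hwD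
      (Set.nonempty_of_ncard_ne_zero (by lia))
  have c2 : 1 ≤ (B ∩ C).ncard → (A ∩ D).ncard ≤ 1 := fun hn => by
    rw [Set.inter_comm] at hn ⊢
    exact h'.ncard_inter_le_one h hy' hS ht.rotate.swap hty' hu hv hwD hwB
      (Set.nonempty_of_ncard_ne_zero (by lia))
  have c3 : 2 ≤ (B ∩ D).ncard → (A ∩ C).ncard ≤ 1 :=
    h.ncard_inter_le_one' h' hy hS ht hty hv hu hwB
  obtain ⟨p, hpA, hp⟩ := h.tri_of_small h' hy hS hV ht hty hv hu hwB hwD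
    (by lia) (by lia) (by lia)
  exact Or.inl ⟨p, fun e => h.notMem_of_mem hpA (e ▸ hwB), hp⟩

end IsSplit

end Triangles

section Minors

variable {V : Type*} [Fintype V] [DecidableEq V] {S : IsotropicSystem V} {t t' : V → K}
  {u v w x y p q : V}

/-- Vectors of the minor supported in `X` come from vectors of `S` supported in `X ∪ {u}` with value
`0` or `y` at `u`. -/
theorem conn_minor_ge (S : IsotropicSystem V) (u : V) {y : K} (hy : y ≠ 0)
    (X : Set {w // w ≠ u}) :
    ((Subtype.val '' X).ncard : ℤ) - Module.finrank (ZMod 2)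
      (S.space ⊓ supportedIn (insert u (Subtype.val '' X)) ⊓ valueIn u y :
        Submodule (ZMod 2) (V → K)) ≤ (S.minor u y hy).conn X := by
  rw [conn_eq, Set.ncard_image_of_injective _ Subtype.val_injective]
  have hle : (S.minor u y hy).space ⊓ supportedIn X ≤
      (S.space ⊓ supportedIn (insert u (Subtype.val '' X)) ⊓ valueIn u y).map
        (proj fun w => w ≠ u) := by
    rintro _ ⟨⟨a, ⟨ha, hau⟩, rfl⟩, haX⟩
    refine ⟨a, ⟨⟨ha, fun w hw => ?_⟩, hau⟩, rfl⟩
    by_cases hwu : w = u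
    · exact Or.inl hwu
    · exact Or.inr ⟨⟨w, hwu⟩, haX hw, rfl⟩
  have h1 := Submodule.finrank_mono hle
  have h2 := Submodule.finrank_map_le (proj fun w => w ≠ u)
    (S.space ⊓ supportedIn (insert u (Subtype.val '' X)) ⊓ valueIn u y)
  unfold suppDim
  lia

/-- If the minor of `S` at `u` with respect to `y` is not `3`-connected, then this is witnessed by a
split. -/
theorem exists_isSplit (hS : S.IsKConnected 3) (hV : 4 ≤ Fintype.card V) {y : K} (hy : y ≠ 0)
    (h : ¬ (S.minor u y hy).IsKConnected 3) : ∃ A B, S.IsSplit u y A B := by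
  unfold IsKConnected at h
  push Not at h
  obtain ⟨k, hk1, hk3, X, Y, hXY, hdis, hmin, hconn⟩ := h
  set A : Set V := Subtype.val '' X with hA
  set B : Set V := Subtype.val '' Y with hB
  have huA : u ∉ A := by rintro ⟨z, _, hz⟩; exact z.2 hz
  have huB : u ∉ B := by rintro ⟨z, _, hz⟩; exact z.2 hz
  have hcov : ∀ w, w ≠ u → w ∈ A ∨ w ∈ B := by
    intro w hw
    have : (⟨w, hw⟩ : {w // w ≠ u}) ∈ X ∪ Y := by rw [hXY]; trivial
    exact this.imp (fun h => ⟨_, h, rfl⟩) fun h => ⟨_, h, rfl⟩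
  have hAB : Disjoint A B := Set.disjoint_image_of_injective Subtype.val_injective hdis
  have nA : A.ncard = X.ncard := Set.ncard_image_of_injective _ Subtype.val_injective
  have nB : B.ncard = Y.ncard := Set.ncard_image_of_injective _ Subtype.val_injective
  have hcA : Aᶜ = insert u B := by
    ext z
    have e1 := hcov z
    have e2 : z ∈ A → z ∉ B := fun h => Set.disjoint_left.1 hAB h
    have e3 : z = u → z ∉ A := by rintro rfl; exact huA
    simp only [Set.mem_compl_iff, Set.mem_insert_iff]
    tauto
  have hcB : Bᶜ = insert u A := by
    rw [← compl_inj_iff, compl_compl]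
    ext z
    have e1 := hcov z
    have e2 : z ∈ A → z ∉ B := fun h => Set.disjoint_left.1 hAB h
    have e3 : z = u → z ∉ B := by rintro rfl; exact huB
    simp only [Set.mem_compl_iff, Set.mem_insert_iff]
    tauto
  have ncA := Set.ncard_add_ncard_compl A
  rw [hcA, Set.ncard_insert_of_notMem huB, Nat.card_eq_fintype_card] at ncA
  have hge := S.conn_minor_ge u hy X
  rw [← hA] at hge
  set M := S.space ⊓ supportedIn (insert u A) ⊓ valueIn u y with hM
  have hXk : k ≤ X.ncard := hmin.trans (min_le_left _ _)
  have hYk : k ≤ Y.ncard := hmin.trans (min_le_right _ _)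
  -- a `1`-separation of the minor with a single element in `A` would give a vector with at most two
  -- nonzero entries
  have hA2 : 2 ≤ A.ncard := by
    by_contra hlt
    have hne : M ≠ ⊥ := by
      intro h0
      rw [h0, finrank_bot] at hge
      push_cast at hge
      lia
    obtain ⟨m, hm, hm0⟩ := Submodule.exists_mem_ne_zero_of_ne_bot hne
    have h3 := hS.three_le_ncard_support hV hm.1.1 hm0
    have h4 := Set.ncard_le_ncard hm.1.2
    rw [Set.ncard_insert_of_notMem huA] at h4
    lia
  have hcA2 : 2 ≤ S.conn A := hS.two_le_conn hA2 (by
    rw [hcA, Set.ncard_insert_of_notMem huB]; lia)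
  have hcA' := hcA2
  rw [conn_eq] at hcA'
  have hex : ∃ m ∈ M, m u = y := by
    by_contra! hno
    have hle : M ≤ S.space ⊓ supportedIn A := by
      intro a ha
      refine ⟨ha.1.1, fun z hz => (ha.1.2 hz).resolve_left ?_⟩
      rintro rfl
      exact ha.2.elim hz (hno a ha)
    have := Submodule.finrank_mono hle
    unfold suppDim at hcA'
    lia
  obtain ⟨m, hm, hmu⟩ := hex
  -- `M` exceeds the space of vectors supported in `A` by at most one dimension
  have hle : M ≤ (S.space ⊓ supportedIn A) ⊔ Submodule.span (ZMod 2) {m} := by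
    have haux : ∀ a ∈ M, a u = 0 → a ∈ S.space ⊓ supportedIn A := fun a ha hau =>
      ⟨ha.1.1, fun z hz => (ha.1.2 hz).resolve_left (by rintro rfl; exact hz hau)⟩
    intro a ha
    rcases ha.2 with hau | hau
    · exact Submodule.mem_sup_left (haux a ha hau)
    · rw [← sub_add_cancel a m]
      refine Submodule.add_mem_sup (haux _ (M.sub_mem ha hm) ?_)
        (Submodule.mem_span_singleton_self m)
      rw [Pi.sub_apply, hau, hmu, sub_self]
  have hfin : Module.finrank (ZMod 2) M ≤ S.suppDim A + 1 := by
    refine (Submodule.finrank_mono hle).trans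
      ((Submodule.finrank_add_le_finrank_add_finrank _ _).trans ?_)
    have := finrank_span_le_card (R := ZMod 2) ({m} : Set (V → K))
    simp only [Set.toFinset_singleton, Finset.card_singleton] at this
    unfold suppDim
    lia
  have hMle : Module.finrank (ZMod 2) M ≤ S.suppDim (insert u A) :=
    Submodule.finrank_mono inf_le_left
  have hcAle : S.conn A ≤ 2 := by rw [conn_eq]; lia
  have hcBle : S.conn B ≤ 2 := by
    rw [← conn_compl, hcB, conn_eq, Set.ncard_insert_of_notMem huA]; lia
  have hB2 : 2 ≤ B.ncard := by lia
  have hcB2 : 2 ≤ S.conn B := hS.two_le_conn hB2 (by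
    rw [hcB, Set.ncard_insert_of_notMem huA]; lia)
  obtain ⟨m', hm', hmB, hmu'⟩ := S.exists_of_conn_insert_le huB
    (by rw [← hcA, conn_compl]; lia)
  refine ⟨A, B, huA, huB, hcov, hAB, hA2, hB2, hcAle, hcBle, ⟨m, hm.1.1, hm.1.2, hmu⟩,
    ⟨m', hm', hmB, ?_⟩⟩
  rw [← hmu]
  refine S.eq_of_meet hm' hm.1.1 (fun z hz => ?_) hmu' (hmu ▸ hy)
  by_contra! hne
  exact Set.disjoint_left.1 hAB ((hm.1.2 hne.2).resolve_left hz) ((hmB hne.1).resolve_left hz)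

/-- The elementary minor of `S` at an element of a triangle, with respect to the value of the
triangle, is not `3`-connected: the other two elements form one side of a `2`-separation. -/
theorem IsTriVec.not_isKConnected_minor (hV : 5 ≤ Fintype.card V) (ht : S.IsTriVec t u v w) :
    ¬ (S.minor u (t u) ht.ne₁).IsKConnected 3 := by
  intro hcon
  set X : Set {z // z ≠ u} := {⟨v, ht.ne_ab.symm⟩, ⟨w, ht.ne_ac.symm⟩} with hX
  have hX2 : X.ncard = 2 := Set.ncard_pair (by simpa using ht.ne_bc)
  have hn := Set.ncard_add_ncard_compl X
  rw [Nat.card_eq_fintype_card, Fintype.card_subtype_compl, Fintype.card_subtype_eq] at hn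
  refine hcon 2 (by lia) (by lia) ⟨X, Xᶜ, Set.union_compl_self X, disjoint_compl_right,
    le_min (by lia) (by lia), ?_⟩
  have := (S.minor u (t u) ht.ne₁).conn_lt_of_mem (X := X)
    (m := proj (fun z => z ≠ u) t) ⟨t, ⟨ht.mem, Or.inr rfl⟩, rfl⟩ ?_ ?_
  · rw [hX2] at this
    exact this
  · intro z hz
    rcases (ht.ne_zero_iff z).1 hz with h | h | h
    · exact absurd h z.2
    · exact Or.inl (Subtype.ext h)
    · exact Or.inr (Subtype.ext h)
  · intro h0
    exact ht.ne₂ (congrFun h0 ⟨v, ht.ne_ab.symm⟩)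

/-- Two triangles that share `x` and `y` have distinct values at `x`, and neither value gives a
`3`-connected minor. -/
theorem not_isNonessential_of_tri_of_tri (hS : S.IsKConnected 3) (hV : 5 ≤ Fintype.card V)
    (h : S.Tri x y p) (h' : S.Tri x y q) (hpq : p ≠ q) : ¬ S.IsNonessential x := by
  obtain ⟨t, ht⟩ := h
  obtain ⟨t', ht'⟩ := h'
  have hne := ht.ne_of_common hS (by lia) ht' hpq
  rintro ⟨a, b, ha, hb, hab, hca, hcb⟩
  have key : ∀ a b c : K, a ≠ 0 → b ≠ 0 → a ≠ b → c ≠ 0 → c = a ∨ c = b ∨ c = a + b := by decide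
  have h1 := ht.not_isKConnected_minor hV
  have h2 := ht'.not_isKConnected_minor hV
  rcases key a b (t x) ha hb hab ht.ne₁ with e | e | e
  · subst e; contradiction
  · subst e; contradiction
  rcases key a b (t' x) ha hb hab ht'.ne₁ with e' | e' | e'
  · subst e'; contradiction
  · subst e'; contradiction
  exact hne (e.trans e'.symm)

theorem exists_isSplit_of_essential (hS : S.IsKConnected 3) (hV : 5 ≤ Fintype.card V)
    (ht : S.IsTriVec t u v w) (hu : ¬ S.IsNonessential u) :
    ∃ y A B, y ≠ 0 ∧ t u ≠ y ∧ S.IsSplit u y A B ∧ v ∈ A := by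
  have key : ∀ a : K, a ≠ 0 → ∃ b c, b ≠ 0 ∧ c ≠ 0 ∧ b ≠ c ∧ a ≠ b ∧ a ≠ c := by decide
  obtain ⟨b, c, hb, hc, hbc, hab, hac⟩ := key (t u) ht.ne₁
  have : ∃ y, ∃ hy : y ≠ 0, t u ≠ y ∧ ¬ (S.minor u y hy).IsKConnected 3 := by
    by_cases h1 : (S.minor u b hb).IsKConnected 3
    · exact ⟨c, hc, hac, fun h2 => hu ⟨b, c, hb, hc, hbc, h1, h2⟩⟩
    · exact ⟨b, hb, hab, h1⟩
  obtain ⟨y, hy, hty, hy'⟩ := this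
  obtain ⟨A, B, hsp⟩ := exists_isSplit hS (by lia) hy hy'
  rcases hsp.cover v ht.ne_ab.symm with hv | hv
  · exact ⟨y, A, B, hy, hty, hsp, hv⟩
  · exact ⟨y, B, A, hy, hty, hsp.symm, hv⟩

/-- The analogue for isotropic systems of Tutte's triangle lemma for matroids. -/
theorem Tri.exists_tri (hS : S.IsKConnected 3) (hV : 5 ≤ Fintype.card V)
    (h : S.Tri u v w) (hu : ¬ S.IsNonessential u) (hv : ¬ S.IsNonessential v) :
    (∃ p, p ≠ w ∧ S.Tri u v p) ∨ ∃ p, p ≠ v ∧ S.Tri u w p := by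
  obtain ⟨t, ht⟩ := h
  obtain ⟨y, A, B, hy, hty, hsp, hvA⟩ := exists_isSplit_of_essential hS hV ht hu
  obtain ⟨y', C, D, hy', hty', hsp', huC⟩ := exists_isSplit_of_essential hS hV ht.rotate.swap hv
  exact hsp.exists_tri hsp' hy hy' hS (by lia) ht hty hty' hvA huC

end Minors

end IsotropicSystem

/-! ### Cyclic systems and local structure of the triangle hypergraph -/

namespace IsotropicSystem

theorem ncard_triple {α : Type*} {a b c : α} (hab : a ≠ b) (hac : a ≠ c) (hbc : b ≠ c) :
    ({a, b, c} : Set α).ncard = 3 :=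
  Set.ncard_eq_three.2 ⟨a, b, c, hab, hac, hbc, rfl⟩

section Cyclic

variable {V : Type*} [Fintype V] {S : IsotropicSystem V} {n : ℕ}

theorem add_one_ne_zero_of_three_le (hn : 3 ≤ n) :
    (1 + 1 : Fin (n + 2)) ≠ 0 ∧ (1 + 1 + 1 : Fin (n + 2)) ≠ 0 ∧
      (1 + 1 + 1 + 1 : Fin (n + 2)) ≠ 0 := by
  refine ⟨?_, ?_, ?_⟩ <;> intro h <;> have := congrArg Fin.val h <;>
    simp only [Fin.val_add, Fin.val_one, Fin.val_zero] at this
  · rw [Nat.mod_eq_of_lt] at this <;> lia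
  · rw [Nat.mod_eq_of_lt (by lia : 1 + 1 < n + 2), Nat.mod_eq_of_lt] at this <;> lia
  · rw [Nat.mod_eq_of_lt (by lia : 1 + 1 < n + 2), Nat.mod_eq_of_lt (by lia : 1 + 1 + 1 < n + 2),
      Nat.mod_eq_of_lt] at this <;> lia

/-- If `V` has a cyclic ordering in which any three consecutive elements form a triangle, then `S`
is cyclic: the triangles are the fundamental basis with respect to the vector `a` whose value at
each element is the common value of the triangles centred at its two neighbours. -/
theorem isCyclic_of_cyclic_order (hS : S.IsKConnected 3) (hn : 3 ≤ n) (v : Fin (n + 2) ≃ V)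
    (h : ∀ i, S.Tri (v (i - 1)) (v i) (v (i + 1))) : S.IsCyclic := by
  have hV : Fintype.card V = n + 2 := by rw [← Fintype.card_congr v, Fintype.card_fin]
  obtain ⟨h2, h3, h4⟩ := add_one_ne_zero_of_three_le hn
  choose t ht using h
  have hagree : ∀ i, t (i - 1) (v i) = t (i + 1) (v i) := by
    intro i
    refine S.eq_of_meet (ht _).mem (ht _).mem (fun w hw => ?_)
      (((ht _).ne_zero_iff _).2 (by simp)) (((ht _).ne_zero_iff _).2 (by simp))
    obtain ⟨j, rfl⟩ := v.surjective w
    by_contra! hne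
    rw [(ht _).ne_zero_iff, (ht _).ne_zero_iff] at hne
    simp only [v.injective.eq_iff, sub_add_cancel, add_sub_cancel_right] at hne
    have hji : j ≠ i := fun e => hw (e ▸ rfl)
    obtain ⟨ha, hb⟩ := hne
    rcases hb with hb | hb | hb
    · exact hji hb
    · rcases ha with ha | ha | ha
      · refine h3 ?_
        rw [ha, ← sub_eq_zero] at hb
        rw [← neg_eq_zero, ← hb]; abel
      · refine h2 ?_
        rw [ha, ← sub_eq_zero] at hb
        rw [← neg_eq_zero, ← hb]; abel
      · exact hji ha
    · rcases ha with ha | ha | ha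
      · refine h4 ?_
        rw [ha, ← sub_eq_zero] at hb
        rw [← neg_eq_zero, ← hb]; abel
      · refine h3 ?_
        rw [ha, ← sub_eq_zero] at hb
        rw [← neg_eq_zero, ← hb]; abel
      · exact hji ha
  have hdis : ∀ i, t i (v i) ≠ t (i + 1) (v i) := by
    intro i
    have h' := ht (i + 1)
    rw [add_sub_cancel_right] at h'
    refine (ht i).rotate.ne_of_common hS (by lia) h' fun e => ?_
    have e' := v.injective e
    refine h3 ?_
    rw [← sub_eq_zero] at e'
    rw [← neg_eq_zero, ← e']; abel
  set a : V → K := fun x => t (v.symm x + 1) x with ha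
  have hav : ∀ i, a (v i) = t (i + 1) (v i) := fun i => by simp [ha]
  have ha0 : ∀ i, a (v i) ≠ 0 := fun i => by
    rw [hav, (ht _).ne_zero_iff]; simp
  set b : V → V → K := fun x => t (v.symm x) with hb
  have hbv : ∀ i, b (v i) = t i := fun i => by simp [hb]
  have hb1 : ∀ i, formK (t i (v i)) (a (v i)) = 1 := fun i =>
    formK_eq_one (ht i).ne₂ (ha0 i) (by rw [hav]; exact hdis i)
  have hb0 : ∀ i j, j ≠ i → formK (t i (v j)) (a (v j)) = 0 := by
    intro i j hji
    by_cases h0 : t i (v j) = 0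
    · rw [h0, map_zero, LinearMap.zero_apply]
    have heq : t i (v j) = a (v j) := by
      rw [hav]
      rw [← Ne, (ht i).ne_zero_iff] at h0
      simp only [v.injective.eq_iff] at h0
      rcases h0 with rfl | rfl | rfl
      · rw [sub_add_cancel]
      · exact absurd rfl hji
      · rw [← hagree, add_sub_cancel_right]
    exact formK_eq_zero_of_mem (x := a (v j)) (Or.inr heq) (Or.inr rfl)
  refine ⟨a, (SimpleGraph.cycleGraph (n + 2)).comap v.symm, n + 2, ⟨⟨?_, ?_⟩, b, ?_, ?_⟩, by lia,
    ⟨SimpleGraph.Iso.comap v.symm _⟩⟩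
  · intro x
    obtain ⟨i, rfl⟩ := v.surjective x
    exact ha0 i
  · rintro X ⟨x, hx⟩ hmem
    obtain ⟨i, rfl⟩ := v.surjective x
    have := S.formK_eq_zero_of_meet (ht i).mem hmem (x := v i) fun w hw => ?_
    · rw [Set.indicator_of_mem hx, hb1] at this
      exact one_ne_zero this
    · obtain ⟨j, rfl⟩ := v.surjective w
      by_cases hj : v j ∈ X
      · rw [Set.indicator_of_mem hj]
        exact hb0 i j fun e => hw (e ▸ rfl)
      · rw [Set.indicator_of_notMem hj, map_zero]
  · intro x
    obtain ⟨i, rfl⟩ := v.surjective x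
    rw [hbv]
    refine ⟨(ht i).mem, hb1 i, fun w hw => ?_⟩
    obtain ⟨j, rfl⟩ := v.surjective w
    exact hb0 i j fun e => hw (e ▸ rfl)
  · intro x y
    obtain ⟨i, rfl⟩ := v.surjective x
    obtain ⟨j, rfl⟩ := v.surjective y
    rw [hbv, (ht i).ne_zero_iff, SimpleGraph.comap_adj, SimpleGraph.cycleGraph_adj]
    simp only [v.injective.eq_iff, Equiv.symm_apply_apply, ne_eq]
    constructor
    · intro hij
      refine ⟨fun e => ?_, ?_⟩
      · subst e; simp at hij
      · rcases hij with e | e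
        · left; rw [← e]; abel
        · right; right; rw [← e]; abel
    · rintro ⟨hne, e | e | e⟩
      · left; rw [e]; abel
      · exact absurd e.symm hne
      · right; rw [e]; abel

variable {a b c d e f p q r s x y z : V}

/-- By symmetry of the connectivity function, three elements form a triangle as soon as the
connectivity of their complement is at most two. -/
theorem tri_of_conn_compl_le (hS : S.IsKConnected 3) (hV : 4 ≤ Fintype.card V) (hab : a ≠ b)
    (hac : a ≠ c) (hbc : b ≠ c) (h : S.conn {a, b, c}ᶜ ≤ 2) : S.Tri a b c :=
  tri_of_conn_le hS hV hab hac hbc (by rwa [conn_compl] at h)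

theorem Tri.conn_le (h : S.Tri a b c) : S.conn {a, b, c} ≤ 2 := by
  obtain ⟨t, ht⟩ := h
  have h1 := S.conn_lt_of_mem ht.mem ht.support_eq.subset fun h0 => ht.ne₁ (congrFun h0 a)
  rw [← ht.support_eq, ht.ncard_support] at h1
  rw [← ht.support_eq]
  lia

theorem isCyclic_of_card_eq_five (hS : S.IsKConnected 3) (hV : Fintype.card V = 5) :
    S.IsCyclic := by
  have v : Fin (3 + 2) ≃ V := (Fintype.equivFinOfCardEq hV).symm
  refine isCyclic_of_cyclic_order hS le_rfl v fun i => ?_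
  have key : ∀ i : Fin (3 + 2), i - 1 ≠ i ∧ i - 1 ≠ i + 1 ∧ i ≠ i + 1 := by decide
  have h1 := v.injective.ne (key i).1
  have h2 := v.injective.ne (key i).2.1
  have h3 := v.injective.ne (key i).2.2
  refine tri_of_conn_compl_le hS (by lia) h1 h2 h3 ((S.conn_le_ncard _).trans ?_)
  have h4 := Set.ncard_add_ncard_compl {v (i - 1), v i, v (i + 1)}
  rw [ncard_triple h1 h2 h3, Nat.card_eq_fintype_card] at h4
  lia

theorem ncard_compl_le_one (hS : S.IsKConnected 3) {X : Set V} (hX : 2 ≤ X.ncard)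
    (hc : S.conn X < 2) : Xᶜ.ncard ≤ 1 := by
  by_contra h
  have := hS.two_le_conn hX (by lia)
  lia

/-- If there are at least six elements, then no four of them contain three triangles. -/
theorem Tri.not_tri (hS : S.IsKConnected 3) (hV : 6 ≤ Fintype.card V) (h₁ : S.Tri x y p)
    (h₂ : S.Tri x y q) (hpq : p ≠ q) : ¬ S.Tri x p q := by
  rintro ⟨t, ht⟩
  have hc := h₁.conn_le
  have h₁ := h₁
  obtain ⟨t', ht'⟩ := h₂
  have hq : q ∉ ({x, y, p} : Set V) := by
    simp [ht'.ne_ac.symm, ht'.ne_bc.symm, hpq.symm]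
  have h1 := S.conn_insert_lt hq ht.mem (by rw [ht.support_eq]; grind) ht.ne₃ ht'.mem
    (by rw [ht'.support_eq]; grind) ht'.ne₃
    (ht.rotate.rotate.ne_of_common hS (by lia) ht'.rotate.rotate h₁.ne_bc.symm)
  have h2 : (insert q {x, y, p} : Set V).ncard = 4 := by
    rw [Set.ncard_insert_of_notMem hq, ncard_triple h₁.ne_ab h₁.ne_ac h₁.ne_bc]
  have h3 := ncard_compl_le_one hS (by lia) (h1.trans_le hc)
  have h4 := Set.ncard_add_ncard_compl (insert q {x, y, p} : Set V)
  rw [Nat.card_eq_fintype_card] at h4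
  lia

/-- Given triangles `{x, y, p}` and `{x, y, q}`, any triangle through `x` but not `y` contains
exactly one of `p` and `q`, since its value at `x` differs from that of at least one of the two. -/
theorem Tri.mem_of_tri (hS : S.IsKConnected 3) (hV : 6 ≤ Fintype.card V) (h₁ : S.Tri x y p)
    (h₂ : S.Tri x y q) (hpq : p ≠ q) (h₃ : S.Tri x a b) (hya : y ≠ a) (hyb : y ≠ b) :
    ((p = a ∨ p = b) ∧ q ≠ a ∧ q ≠ b) ∨ ((q = a ∨ q = b) ∧ p ≠ a ∧ p ≠ b) := by
  have h4 : ¬ ((p = a ∨ p = b) ∧ (q = a ∨ q = b)) := by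
    rintro ⟨rfl | rfl, rfl | rfl⟩
    · exact hpq rfl
    · exact h₁.not_tri hS hV h₂ hpq h₃
    · exact h₁.not_tri hS hV h₂ hpq h₃.swap
    · exact hpq rfl
  have h5 : (p = a ∨ p = b) ∨ (q = a ∨ q = b) := by
    by_contra! hne
    obtain ⟨t₁, ht₁⟩ := h₁
    obtain ⟨t₂, ht₂⟩ := h₂
    obtain ⟨t₃, ht₃⟩ := h₃
    have e₁ : t₁ x = t₃ x := S.eq_of_meet ht₁.mem ht₃.mem (fun w hw => by
      by_contra! h
      rw [ht₁.ne_zero_iff, ht₃.ne_zero_iff] at h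
      grind) ht₁.ne₁ ht₃.ne₁
    have e₂ : t₂ x = t₃ x := S.eq_of_meet ht₂.mem ht₃.mem (fun w hw => by
      by_contra! h
      rw [ht₂.ne_zero_iff, ht₃.ne_zero_iff] at h
      grind) ht₂.ne₁ ht₃.ne₁
    exact ht₁.ne_of_common hS (by lia) ht₂ hpq (e₁.trans e₂.symm)
  tauto

/-- If three triangles contain the pair `x`, `y`, then every triangle through `x` contains `y`. -/
theorem Tri.mem_of_three_tri (hS : S.IsKConnected 3) (hV : 6 ≤ Fintype.card V) (h₁ : S.Tri x y p)
    (h₂ : S.Tri x y q) (h₃ : S.Tri x y r) (hpq : p ≠ q) (hpr : p ≠ r) (hqr : q ≠ r)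
    (h : S.Tri x a b) : y = a ∨ y = b := by
  by_contra! hne
  have e1 := h₁.mem_of_tri hS hV h₂ hpq h hne.1 hne.2
  have e2 := h₁.mem_of_tri hS hV h₃ hpr h hne.1 hne.2
  have e3 := h₂.mem_of_tri hS hV h₃ hqr h hne.1 hne.2
  tauto

/-- At most three triangles contain a given pair, as their values at `x` are distinct. -/
theorem Tri.eq_of_three_tri (hS : S.IsKConnected 3) (hV : 4 ≤ Fintype.card V) (h₁ : S.Tri x y p)
    (h₂ : S.Tri x y q) (h₃ : S.Tri x y r) (hpq : p ≠ q) (hpr : p ≠ r) (hqr : q ≠ r)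
    (h : S.Tri x y a) : a = p ∨ a = q ∨ a = r := by
  by_contra! hne
  obtain ⟨t₁, ht₁⟩ := h₁
  obtain ⟨t₂, ht₂⟩ := h₂
  obtain ⟨t₃, ht₃⟩ := h₃
  obtain ⟨t, ht⟩ := h
  have key : ∀ a b c : K, a ≠ 0 → b ≠ 0 → a ≠ b → c ≠ 0 → c = a ∨ c = b ∨ c = a + b := by decide
  -- four distinct nonzero values do not exist, as the third of them is the sum of the first two
  have e12 := ht₁.ne_of_common hS hV ht₂ hpq
  have e13 := ht₁.ne_of_common hS hV ht₃ hpr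
  have e23 := ht₂.ne_of_common hS hV ht₃ hqr
  have e1 := ht.ne_of_common hS hV ht₁ hne.1
  have e2 := ht.ne_of_common hS hV ht₂ hne.2.1
  have e3 := ht.ne_of_common hS hV ht₃ hne.2.2
  rcases key _ _ _ ht₁.ne₁ ht₂.ne₁ e12 ht₃.ne₁ with h | h | h
  · exact e13 h.symm
  · exact e23 h.symm
  rcases key _ _ _ ht₁.ne₁ ht₂.ne₁ e12 ht.ne₁ with h' | h' | h'
  · exact e1 h'
  · exact e2 h'
  exact e3 (h'.trans h.symm)

/-- With six elements, the complement of a triangle is a triangle. -/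
theorem Tri.tri_of_card_eq_six (hS : S.IsKConnected 3) (hV : Fintype.card V = 6)
    (h : S.Tri a b c) (hde : d ≠ e) (hdf : d ≠ f) (hef : e ≠ f)
    (hdisj : Disjoint ({a, b, c} : Set V) {d, e, f}) : S.Tri d e f := by
  refine tri_of_conn_compl_le hS (by lia) hde hdf hef ?_
  have h1 := Set.ncard_add_ncard_compl ({d, e, f} : Set V)
  rw [ncard_triple hde hdf hef, Nat.card_eq_fintype_card] at h1
  rw [← Set.eq_of_subset_of_ncard_le (Set.subset_compl_iff_disjoint_right.2 hdisj)
    (by rw [ncard_triple h.ne_ab h.ne_ac h.ne_bc]; lia)]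
  exact h.conn_le

/-- Four triangles through `x` that form a cycle on `p`, `q`, `r`, `s` span five elements of
connectivity one. So there are only six elements, and the complements of three of these triangles
are triangles that complete a cyclic order. -/
theorem isCyclic_of_four_tri (hS : S.IsKConnected 3) (hV : 6 ≤ Fintype.card V)
    (h₁ : S.Tri p q x) (h₂ : S.Tri q x r) (h₃ : S.Tri x r s) (h₄ : S.Tri x p s) (hpr : p ≠ r)
    (hqs : q ≠ s) : S.IsCyclic := by
  have hpq := h₁.ne_ab
  have hpx := h₁.ne_ac
  have hqx := h₁.ne_bc
  have hqr := h₂.ne_ac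
  have hxr := h₂.ne_bc
  have hxs := h₃.ne_ac
  have hrs := h₃.ne_bc
  have hps := h₄.ne_bc
  have hc := h₁.conn_le
  obtain ⟨t₂, ht₂⟩ := h₂
  obtain ⟨t₃, ht₃⟩ := h₃
  obtain ⟨t₄, ht₄⟩ := h₄
  have hr : r ∉ ({p, q, x} : Set V) := by simp [hpr.symm, hqr.symm, hxr.symm]
  have hs : s ∉ (insert r {p, q, x} : Set V) := by simp [hrs.symm, hps.symm, hqs.symm, hxs.symm]
  have c1 := S.conn_insert_le hr ht₂.mem (by rw [ht₂.support_eq]; grind) ht₂.ne₃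
  have c2 := S.conn_insert_lt hs ht₃.mem (by rw [ht₃.support_eq]; grind) ht₃.ne₃ ht₄.mem
    (by rw [ht₄.support_eq]; grind) ht₄.ne₃
    (ht₃.rotate.rotate.ne_of_common hS (by lia) ht₄.rotate.rotate hpr.symm)
  have hn : (insert s (insert r {p, q, x}) : Set V).ncard = 5 := by
    rw [Set.ncard_insert_of_notMem hs, Set.ncard_insert_of_notMem hr, ncard_triple hpq hpx hqx]
  have c3 := ncard_compl_le_one hS (X := insert s (insert r {p, q, x})) (by lia) (by lia)
  have hn' := Set.ncard_add_ncard_compl (insert s (insert r {p, q, x}) : Set V)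
  rw [Nat.card_eq_fintype_card] at hn'
  have h6 : Fintype.card V = 6 := by lia
  obtain ⟨z, hz⟩ := Set.nonempty_of_ncard_ne_zero
    (s := (insert s (insert r {p, q, x}) : Set V)ᶜ) (by lia)
  simp only [Set.mem_compl_iff, Set.mem_insert_iff, Set.mem_singleton_iff, not_or] at hz
  obtain ⟨hzs, hzr, hzp, hzq, hzx⟩ := hz
  have d₁ : S.Tri p q z := Tri.tri_of_card_eq_six hS h6 ⟨t₃, ht₃⟩ hpq (Ne.symm hzp) (Ne.symm hzq)
    (by rw [Set.disjoint_left]; grind)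
  have d₂ : S.Tri q z r := Tri.tri_of_card_eq_six hS h6 ⟨t₄, ht₄⟩ (Ne.symm hzq) hqr hzr
    (by rw [Set.disjoint_left]; grind)
  have d₃ : S.Tri z r s := Tri.tri_of_card_eq_six hS h6 h₁ hzr hzs hrs
    (by rw [Set.disjoint_left]; grind)
  set v : Fin (4 + 2) → V := ![x, p, q, z, r, s] with hv
  have hinj : Function.Injective v := by
    intro i j hij
    fin_cases i <;> fin_cases j <;> simp [hv] at hij ⊢ <;> grind
  have hbij : Function.Bijective v :=
    (Fintype.bijective_iff_injective_and_card v).2 ⟨hinj, by simp [h6]⟩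
  refine isCyclic_of_cyclic_order hS (by lia) (Equiv.ofBijective v hbij) fun i => ?_
  fin_cases i
  · exact ⟨t₄, ht₄.rotate.rotate⟩
  · exact h₁.rotate.rotate
  · exact d₁
  · exact d₂
  · exact d₃
  · exact ⟨t₃, ht₃.rotate⟩

theorem mem_edgeSet_iff {e : Set V} :
    e ∈ S.triangleHypergraph.edgeSet ↔ ∃ a b c, S.Tri a b c ∧ e = {a, b, c} := by
  constructor
  · rintro ⟨t, ⟨ht, h3⟩, rfl⟩
    obtain ⟨a, b, c, hab, hac, hbc, h⟩ := Set.ncard_eq_three.1 h3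
    refine ⟨a, b, c, ⟨t, ht, hab, hac, hbc, fun w => ?_⟩, h⟩
    rw [← Function.mem_support, h]
    simp
  · rintro ⟨a, b, c, ⟨t, ht⟩, rfl⟩
    exact ⟨t, ⟨ht.mem, ht.ncard_support⟩, ht.support_eq.symm⟩

theorem Tri.mem_edgeSet (h : S.Tri a b c) : {a, b, c} ∈ S.triangleHypergraph.edgeSet :=
  mem_edgeSet_iff.2 ⟨a, b, c, h, rfl⟩

theorem exists_tri_of_mem {e : Set V} (he : e ∈ S.triangleHypergraph.edgeSet) (hx : x ∈ e) :
    ∃ a b, S.Tri x a b ∧ e = {x, a, b} := by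
  obtain ⟨a, b, c, h, rfl⟩ := mem_edgeSet_iff.1 he
  rcases hx with rfl | rfl | rfl
  · exact ⟨b, c, h, rfl⟩
  · exact ⟨a, c, h.swap₁₂, by grind⟩
  · exact ⟨a, b, h.rotate.rotate, by grind⟩

theorem Tri.exists_third (h : S.Tri x a b) (hy : y = a ∨ y = b) :
    ∃ c, S.Tri x y c ∧ ({x, a, b} : Set V) = {x, y, c} ∧ (c = a ∨ c = b) := by
  rcases hy with rfl | rfl
  · exact ⟨b, h, rfl, Or.inr rfl⟩
  · exact ⟨a, h.swap, by grind, Or.inl rfl⟩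

/-- The middle element of a tight path of length three is in no edge outside that path. -/
theorem eq_of_mem_of_tight_path (hS : S.IsKConnected 3) (hV : 6 ≤ Fintype.card V)
    (hcyc : ¬ S.IsCyclic) (h₁ : S.Tri p q x) (h₂ : S.Tri q x r) (h₃ : S.Tri x r s)
    (hpr : p ≠ r) (hqs : q ≠ s) {e : Set V}
    (he : e ∈ S.triangleHypergraph.edgeSet) (hx : x ∈ e) :
    e = {p, q, x} ∨ e = {q, x, r} ∨ e = {x, r, s} := by
  obtain ⟨a, b, h, rfl⟩ := exists_tri_of_mem he hx
  have k₁ := h₁.rotate.rotate.swap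
  have k₂ := h₂.swap₁₂
  by_cases hq : q = a ∨ q = b
  · obtain ⟨c, hc, hcs, -⟩ := h.exists_third hq
    rw [hcs]
    by_cases hcp : c = p
    · left; grind
    by_cases hcr : c = r
    · right; left; grind
    rcases Tri.mem_of_three_tri hS hV k₁ k₂ hc hpr (Ne.symm hcp) (Ne.symm hcr) h₃ with h | h
    · exact absurd h h₂.ne_ac
    · exact absurd h hqs
  by_cases hr : r = a ∨ r = b
  · obtain ⟨c, hc, hcs, -⟩ := h.exists_third hr
    rw [hcs]
    by_cases hcs : c = s
    · right; right; grind
    by_cases hcq : c = q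
    · right; left; grind
    rcases Tri.mem_of_three_tri hS hV k₂.swap h₃ hc hqs (Ne.symm hcq) (Ne.symm hcs) k₁ with h | h
    · exact absurd h h₂.ne_ac.symm
    · exact absurd h.symm hpr
  push Not at hq hr
  have m₁ := k₁.mem_of_tri hS hV k₂ hpr h hq.1 hq.2
  have m₂ := k₂.swap.mem_of_tri hS hV h₃ hqs h hr.1 hr.2
  have hp : p = a ∨ p = b := by tauto
  have hs : s = a ∨ s = b := by tauto
  refine absurd ?_ hcyc
  by_cases hps : p = s
  · -- then the three triangles through `x` lie in the four elements `x`, `p`, `q`, `r`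
    subst hps
    exact absurd h₃ (k₂.not_tri hS hV k₁ hpr.symm)
  refine isCyclic_of_four_tri hS hV h₁ h₂ h₃ ?_ hpr hqs
  rcases hp with rfl | rfl <;> rcases hs with rfl | rfl
  · exact absurd rfl hps
  · exact h
  · exact h.swap
  · exact absurd rfl hps

/-- In the configuration of a table, `a` is the middle element of the tight path `x, b, a, c, z`. -/
theorem eq_of_mem_of_table (hS : S.IsKConnected 3) (hV : 6 ≤ Fintype.card V) (hcyc : ¬ S.IsCyclic)
    (h : S.Tri a b c) (hx : S.Tri a b x) (hz : S.Tri a c z) (hxc : x ≠ c) (hzb : z ≠ b)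
    {e : Set V} (he : e ∈ S.triangleHypergraph.edgeSet) (hae : a ∈ e) :
    e = {a, b, c} ∨ e = {a, b, x} ∨ e = {a, c, z} := by
  rcases eq_of_mem_of_tight_path hS hV hcyc hx.reverse h.swap₁₂ hz hxc hzb.symm he hae
    with rfl | rfl | rfl
  · right; left; grind
  · left; grind
  · right; right; rfl

end Cyclic

end IsotropicSystem

/-! ### Tight paths of triangles -/

namespace IsotropicSystem

section SeqEdge

variable {V : Type*} {v : ℕ → V} {k i : ℕ} {p : V} {e : Set V}

/-- The `i`-th edge `{v i, v (i + 1), v (i + 2)}` of the tight path along the sequence `v`. -/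
def seqEdge (v : ℕ → V) (i : ℕ) : Set V := {v i, v (i + 1), v (i + 2)}

theorem seqEdge_reverse (v : ℕ → V) (hi : i < k) :
    seqEdge (fun i => v (k + 1 - i)) i = seqEdge v (k - 1 - i) := by
  simp only [seqEdge]
  rw [show k - 1 - i + 2 = k + 1 - i by lia, show k - 1 - i + 1 = k + 1 - (i + 1) by lia,
    show k - 1 - i = k + 1 - (i + 2) by lia]
  grind

theorem seqEdge_update (hi : i < k) : seqEdge (Function.update v (k + 2) p) i = seqEdge v i := by
  simp only [seqEdge]
  rw [Function.update_of_ne (by lia), Function.update_of_ne (by lia),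
    Function.update_of_ne (by lia)]

theorem exists_seqEdge_reverse :
    (∃ i < k, e = seqEdge (fun i => v (k + 1 - i)) i) ↔ ∃ i < k, e = seqEdge v i := by
  constructor
  · rintro ⟨i, hi, rfl⟩
    exact ⟨k - 1 - i, by lia, seqEdge_reverse v hi⟩
  · rintro ⟨i, hi, rfl⟩
    refine ⟨k - 1 - i, by lia, ?_⟩
    rw [seqEdge_reverse v (by lia), show k - 1 - (k - 1 - i) = i by lia]

/-- The tight path of length `k` along the sequence `v`. -/
def seqPath (v : ℕ → V) (k : ℕ) : Hypergraph V where
  vertexSet := v '' Set.Iic (k + 1)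
  edgeSet := {e | ∃ i < k, e = seqEdge v i}
  subset_vertexSet_of_mem_edgeSet' := by
    rintro _ ⟨i, hi, rfl⟩ x (rfl | rfl | rfl)
    · exact ⟨i, by simp only [Set.mem_Iic]; lia, rfl⟩
    · exact ⟨i + 1, by simp only [Set.mem_Iic]; lia, rfl⟩
    · exact ⟨i + 2, by simp only [Set.mem_Iic]; lia, rfl⟩

end SeqEdge

section TightSeq

variable {V : Type*} [Fintype V] {S : IsotropicSystem V} {v : ℕ → V} {k l i j : ℕ} {e e₀ : Set V}
  {p : V}

/-- The first `k + 2` terms of the sequence `v` are distinct, and any three consecutive ones among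
them form a triangle; the later terms are irrelevant. -/
structure IsTightSeq (S : IsotropicSystem V) (v : ℕ → V) (k : ℕ) : Prop where
  injOn : Set.InjOn v (Set.Iic (k + 1))
  tri : ∀ i < k, S.Tri (v i) (v (i + 1)) (v (i + 2))

namespace IsTightSeq

theorem eq_iff (h : S.IsTightSeq v k) (hi : i ≤ k + 1) (hj : j ≤ k + 1) : v i = v j ↔ i = j :=
  ⟨fun e => h.injOn hi hj e, fun e => e ▸ rfl⟩

theorem ne (h : S.IsTightSeq v k) (hi : i ≤ k + 1) (hj : j ≤ k + 1) (hij : i ≠ j) : v i ≠ v j :=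
  fun e => hij ((h.eq_iff hi hj).1 e)

theorem mem_seqEdge (h : S.IsTightSeq v k) (hi : i < k) (hj : j ≤ k + 1) :
    v j ∈ seqEdge v i ↔ i ≤ j ∧ j ≤ i + 2 := by
  simp only [seqEdge, Set.mem_insert_iff, Set.mem_singleton_iff]
  rw [h.eq_iff hj (by lia), h.eq_iff hj (by lia), h.eq_iff hj (by lia)]
  lia

theorem reverse (h : S.IsTightSeq v k) : S.IsTightSeq (fun i => v (k + 1 - i)) k := by
  refine ⟨fun i hi j hj hij => ?_, fun i hi => ?_⟩
  · have := (h.eq_iff (by lia) (by lia)).1 hij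
    simp only [Set.mem_Iic] at hi hj
    lia
  · have := (h.tri (k - 1 - i) (by lia)).reverse
    rwa [show k - 1 - i + 2 = k + 1 - i by lia, show k - 1 - i + 1 = k + 1 - (i + 1) by lia,
      show k - 1 - i = k + 1 - (i + 2) by lia] at this

theorem le_card (h : S.IsTightSeq v k) : k + 2 ≤ Fintype.card V := by
  have := Set.ncard_le_card (v '' Set.Iic (k + 1))
  rwa [h.injOn.ncard_image, Nat.card_eq_fintype_card (α := V), ← Nat.card_coe_set_eq,
    Nat.card_eq_fintype_card, Fintype.card_Iic, Nat.card_Iic] at this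

theorem extend (h : S.IsTightSeq v k) (hp : ∀ i ≤ k + 1, p ≠ v i)
    (htri : S.Tri (v k) (v (k + 1)) p) : S.IsTightSeq (Function.update v (k + 2) p) (k + 1) := by
  have hlt : ∀ i ≤ k + 1, Function.update v (k + 2) p i = v i := fun i hi =>
    Function.update_of_ne (by lia) _ _
  refine ⟨fun i hi j hj hij => ?_, fun i hi => ?_⟩
  · simp only [Set.mem_Iic] at hi hj
    by_cases hi' : i = k + 2
    · by_cases hj' : j = k + 2
      · rw [hi', hj']
      · rw [hi', Function.update_self, hlt j (by lia)] at hij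
        exact absurd hij (hp j (by lia))
    · by_cases hj' : j = k + 2
      · rw [hj', Function.update_self, hlt i (by lia)] at hij
        exact absurd hij.symm (hp i (by lia))
      · rw [hlt i (by lia), hlt j (by lia)] at hij
        exact (h.eq_iff (by lia) (by lia)).1 hij
  · rw [hlt i (by lia), hlt (i + 1) (by lia)]
    by_cases hik : i = k
    · subst hik
      rwa [Function.update_self]
    · rw [hlt (i + 2) (by lia)]
      exact h.tri i (by lia)

/-- A segment of a tight path has connectivity at most two: every new element is the last element of
a triangle in the segment. -/
theorem conn_segment_le (h : S.IsTightSeq v k) (l : ℕ) (hl : i + l ≤ k) :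
    S.conn (v '' Set.Ico i (i + 2 + l)) ≤ 2 := by
  induction l with
  | zero =>
    refine (S.conn_le_ncard _).trans ?_
    have h1 := Set.ncard_image_le (f := v) (Set.finite_Ico i (i + 2 + 0))
    have h2 : (Set.Ico i (i + 2 + 0)).ncard = 2 := by
      rw [← Nat.card_coe_set_eq, Nat.card_eq_fintype_card, Fintype.card_Ico, Nat.card_Ico]
      lia
    lia
  | succ l ih =>
    obtain ⟨t, ht⟩ := h.tri (i + l) (by lia)
    have h1 : Set.Ico i (i + 2 + (l + 1)) = insert (i + l + 2) (Set.Ico i (i + 2 + l)) := by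
      ext z; simp only [Set.mem_insert_iff, Set.mem_Ico]; lia
    rw [h1, Set.image_insert_eq]
    refine (S.conn_insert_le ?_ ht.mem ?_ ht.ne₃).trans (ih (by lia))
    · rintro ⟨z, hz, hzv⟩
      simp only [Set.mem_Ico] at hz
      have := (h.eq_iff (by lia) (by lia)).1 hzv
      lia
    · rw [ht.support_eq]
      rintro z (rfl | rfl | rfl)
      · exact Or.inr ⟨i + l, by simp only [Set.mem_Ico]; lia, rfl⟩
      · exact Or.inr ⟨i + l + 1, by simp only [Set.mem_Ico]; lia, rfl⟩
      · exact Or.inl rfl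

/-- If the last two elements of a tight path form a triangle with its first element, then the path
contains every element: the triangles of the path and the additional one make the connectivity of
`{v 1, …, v (k + 1)}` at most one. -/
theorem exists_eq_of_closed (h : S.IsTightSeq v (l + 3)) (hS : S.IsKConnected 3)
    (hV : 4 ≤ Fintype.card V) (hc : S.Tri (v (l + 3)) (v (l + 4)) (v 0)) (x : V) :
    ∃ i ≤ l + 4, v i = x := by
  obtain ⟨g, hg⟩ := hc
  obtain ⟨t, ht⟩ := h.tri 0 (by lia)
  obtain ⟨s, hs⟩ := h.tri (l + 1) (by lia)
  obtain ⟨r, hr⟩ := h.tri (l + 2) (by lia)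
  have hadd : ∀ z : K, z + z = 0 := by decide
  have hne : ∀ i j, i ≤ l + 4 → j ≤ l + 4 → i ≠ j → v i ≠ v j := fun i j hi hj =>
    h.ne (by lia) (by lia)
  have e₀ : t (v 0) = g (v 0) := S.eq_of_meet ht.mem hg.mem (fun w hw => by
    by_contra! hw'
    rcases (ht.ne_zero_iff w).1 hw'.1 with rfl | rfl | rfl
    · exact hw rfl
    · exact hw'.2 (hg.eq_zero (hne _ _ (by lia) (by lia) (by lia))
        (hne _ _ (by lia) (by lia) (by lia)) hw)
    · exact hw'.2 (hg.eq_zero (hne _ _ (by lia) (by lia) (by lia))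
        (hne _ _ (by lia) (by lia) (by lia)) hw)) ht.ne₁ hg.ne₃
  have e₁ : g (v (l + 3)) = s (v (l + 3)) := S.eq_of_meet hg.mem hs.mem (fun w hw => by
    by_contra! hw'
    rcases (hs.ne_zero_iff w).1 hw'.2 with rfl | rfl | rfl
    · exact hw'.1 (hg.eq_zero hw (hne _ _ (by lia) (by lia) (by lia))
        (hne _ _ (by lia) (by lia) (by lia)))
    · exact hw'.1 (hg.eq_zero hw (hne _ _ (by lia) (by lia) (by lia))
        (hne _ _ (by lia) (by lia) (by lia)))
    · exact hw rfl) hg.ne₁ hs.ne₃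
  -- `m` vanishes at `v 0`, and `m + s` vanishes at `v (l + 3)` as well
  set m := t + g with hm
  have hmS : m ∈ S.space := S.space.add_mem ht.mem hg.mem
  have hm0 : m (v 0) = 0 := by rw [hm, Pi.add_apply, e₀, hadd]
  have htk : ∀ i, 3 ≤ i → i ≤ l + 4 → t (v i) = 0 := fun i h3 hi =>
    ht.eq_zero (hne _ _ (by lia) (by lia) (by lia)) (hne _ _ (by lia) (by lia) (by lia))
      (hne _ _ (by lia) (by lia) (by lia))
  have hmk : m (v (l + 3)) = g (v (l + 3)) := by
    rw [hm, Pi.add_apply, htk _ (by lia) (by lia), zero_add]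
  have hsuppm : ∀ w, m w ≠ 0 → w = v 1 ∨ w = v 2 ∨ w = v (l + 3) ∨ w = v (l + 4) := by
    intro w hw
    by_contra! hne
    refine hw ?_
    by_cases hw0 : w = v 0
    · rw [hw0, hm0]
    · rw [hm, Pi.add_apply, ht.eq_zero hw0 hne.1 hne.2.1, hg.eq_zero hne.2.2.1 hne.2.2.2 hw0,
        add_zero]
  have hImg : ∀ i, 1 ≤ i → i < l + 3 → v i ∈ v '' Set.Ico 1 (1 + 2 + l) := fun i h1 h2 =>
    ⟨i, by simp only [Set.mem_Ico]; lia, rfl⟩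
  have hnImg : ∀ i, l + 3 ≤ i → i ≤ l + 4 → v i ∉ v '' Set.Ico 1 (1 + 2 + l) := by
    rintro i h1 h2 ⟨j, hj, hji⟩
    simp only [Set.mem_Ico] at hj
    have := (h.eq_iff (by lia) (by lia)).1 hji
    lia
  -- add `v (l + 4)` to the segment `{v 1, …, v (l + 2)}` by `m + s`, and then `v (l + 3)` by `m`
  -- and `r`, which disagree there
  have c0 := h.conn_segment_le (i := 1) l (by lia)
  have c1 := S.conn_insert_le (hnImg (l + 4) (by lia) (by lia)) (m := m + s)
    (S.space.add_mem hmS hs.mem) (fun w hw => by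
      by_contra hw'
      apply hw
      rw [Pi.add_apply]
      by_cases hwk : w = v (l + 3)
      · rw [hwk, hmk, e₁, hadd]
      · have h1 : m w = 0 := by
          by_contra hmw
          rcases hsuppm w hmw with rfl | rfl | rfl | rfl
          · exact hw' (Or.inr (hImg _ (by lia) (by lia)))
          · exact hw' (Or.inr (hImg _ (by lia) (by lia)))
          · exact hwk rfl
          · exact hw' (Or.inl rfl)
        have h2 : s w = 0 := by
          by_contra hsw
          rcases (hs.ne_zero_iff w).1 hsw with rfl | rfl | rfl
          · exact hw' (Or.inr (hImg _ (by lia) (by lia)))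
          · exact hw' (Or.inr (hImg _ (by lia) (by lia)))
          · exact hwk rfl
        rw [h1, h2, add_zero])
    (by
      rw [Pi.add_apply, hm, Pi.add_apply, htk _ (by lia) (by lia), zero_add,
        hs.eq_zero (hne _ _ (by lia) (by lia) (by lia)) (hne _ _ (by lia) (by lia) (by lia))
          (hne _ _ (by lia) (by lia) (by lia)), add_zero]
      exact hg.ne₂)
  have hnm : v (l + 3) ∉ insert (v (l + 4)) (v '' Set.Ico 1 (1 + 2 + l)) := by
    rintro (h1 | h1)
    · exact hne _ _ (by lia) (by lia) (by lia) h1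
    · exact hnImg _ (by lia) (by lia) h1
  have c2 := S.conn_insert_lt hnm (m := m) (m' := r) hmS (fun w hw => by
      rcases hsuppm w hw with rfl | rfl | rfl | rfl
      · exact Or.inr (Or.inr (hImg _ (by lia) (by lia)))
      · exact Or.inr (Or.inr (hImg _ (by lia) (by lia)))
      · exact Or.inl rfl
      · exact Or.inr (Or.inl rfl)) (hmk ▸ hg.ne₁) hr.mem (fun w hw => by
      rcases (hr.ne_zero_iff w).1 hw with rfl | rfl | rfl
      · exact Or.inr (Or.inr (hImg _ (by lia) (by lia)))
      · exact Or.inl rfl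
      · exact Or.inr (Or.inl rfl)) hr.ne₂ (by
      rw [hmk]
      exact hg.ne_of_common hS hV hr.rotate (hne _ _ (by lia) (by lia) (by lia)))
  set X := insert (v (l + 3)) (insert (v (l + 4)) (v '' Set.Ico 1 (1 + 2 + l))) with hX
  have hX2 : 2 ≤ X.ncard := two_le_ncard_of_mem (a := v (l + 3)) (b := v (l + 4)) (Or.inl rfl)
    (Or.inr (Or.inl rfl)) (hne _ _ (by lia) (by lia) (by lia))
  have c3 := ncard_compl_le_one hS hX2 (by lia)
  have h0X : v 0 ∈ Xᶜ := by
    rintro (h1 | h1 | ⟨j, hj, h1⟩)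
    · exact hne _ _ (by lia) (by lia) (by lia) h1
    · exact hne _ _ (by lia) (by lia) (by lia) h1
    · simp only [Set.mem_Ico] at hj
      exact hne _ _ (by lia) (by lia) (by lia) h1
  by_cases hx : x ∈ X
  · rcases hx with rfl | rfl | ⟨j, hj, rfl⟩
    · exact ⟨_, by lia, rfl⟩
    · exact ⟨_, by lia, rfl⟩
    · simp only [Set.mem_Ico] at hj
      exact ⟨j, by lia, rfl⟩
  · exact ⟨0, by lia, Set.ncard_le_one_iff (Set.toFinite _) |>.1 c3 h0X hx⟩

/-- A tight path of length at least three whose last two elements form a triangle with its first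
element makes `S` cyclic. -/
theorem isCyclic_of_closed (h : S.IsTightSeq v (l + 3)) (hS : S.IsKConnected 3)
    (hV : 4 ≤ Fintype.card V) (hc : S.Tri (v (l + 3)) (v (l + 4)) (v 0)) : S.IsCyclic := by
  have hall := h.exists_eq_of_closed hS hV hc
  have hne : ∀ i j, i ≤ l + 4 → j ≤ l + 4 → i ≠ j → v i ≠ v j := fun i j hi hj =>
    h.ne (by lia) (by lia)
  -- the remaining three consecutive elements are the complement of a segment of the path
  have hlast : S.Tri (v (l + 4)) (v 0) (v 1) := by
    refine tri_of_conn_compl_le hS hV (hne _ _ (by lia) (by lia) (by lia))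
      (hne _ _ (by lia) (by lia) (by lia)) (hne _ _ (by lia) (by lia) (by lia)) ?_
    have heq : ({v (l + 4), v 0, v 1} : Set V)ᶜ = v '' Set.Ico 2 (2 + 2 + l) := by
      ext x
      obtain ⟨i, hi, rfl⟩ := hall x
      simp only [Set.mem_compl_iff, Set.mem_insert_iff, Set.mem_singleton_iff, Set.mem_image,
        Set.mem_Ico]
      rw [h.eq_iff (by lia) (by lia), h.eq_iff (by lia) (by lia), h.eq_iff (by lia) (by lia)]
      constructor
      · exact fun hi' => ⟨i, by lia, rfl⟩
      · rintro ⟨j, hj, hji⟩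
        have := (h.eq_iff (by lia) (by lia)).1 hji
        lia
    rw [heq]
    exact h.conn_segment_le l (by lia)
  set f : Fin (l + 3 + 2) → V := fun i => v i with hf
  have hbij : Function.Bijective f := by
    refine ⟨fun i j hij => Fin.ext ((h.eq_iff (by lia) (by lia)).1 hij), fun x => ?_⟩
    obtain ⟨i, hi, rfl⟩ := hall x
    exact ⟨⟨i, by lia⟩, rfl⟩
  refine isCyclic_of_cyclic_order hS (by lia) (Equiv.ofBijective f hbij) fun i => ?_
  simp only [Equiv.ofBijective_apply, hf]
  by_cases h0 : i = 0
  · subst h0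
    have h1 : ((0 - 1 : Fin (l + 3 + 2)) : ℕ) = l + 4 := by
      rw [zero_sub, Fin.coe_neg_one]
    have h2 : ((0 + 1 : Fin (l + 3 + 2)) : ℕ) = 1 := by
      rw [zero_add]; rfl
    rw [h1, h2]
    exact hlast
  have h1 : ((i - 1 : Fin (l + 3 + 2)) : ℕ) = i - 1 := Fin.val_sub_one_of_ne_zero h0
  have hi0 : (i : ℕ) ≠ 0 := fun e => h0 (Fin.ext e)
  rw [h1]
  by_cases hl : i = Fin.last _
  · subst hl
    have h2 : ((Fin.last (l + 3 + 1) + 1 : Fin (l + 3 + 2)) : ℕ) = 0 := by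
      rw [Fin.last_add_one]; rfl
    rw [h2]
    exact hc
  · have h2 : ((i + 1 : Fin (l + 3 + 2)) : ℕ) = i + 1 :=
      Fin.val_add_one_of_lt (Fin.lt_last_iff_ne_last.2 hl)
    rw [h2]
    have hil : (i : ℕ) ≠ l + 4 := fun e => hl (Fin.ext e)
    have := h.tri (i - 1) (by lia)
    rwa [show (i : ℕ) - 1 + 1 = i by lia, show (i : ℕ) - 1 + 2 = i + 1 by lia] at this

/-- Apart from the first and the last one, the internal elements of a tight path are only in
edges of the path. -/
theorem exists_seqEdge_of_mem (h : S.IsTightSeq v k) (hS : S.IsKConnected 3)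
    (hV : 6 ≤ Fintype.card V) (hcyc : ¬ S.IsCyclic) (hj : 2 ≤ j) (hjk : j < k)
    (he : e ∈ S.triangleHypergraph.edgeSet) (hx : v j ∈ e) : ∃ i < k, e = seqEdge v i := by
  obtain ⟨j, rfl⟩ := Nat.exists_eq_add_of_le' hj
  rcases eq_of_mem_of_tight_path hS hV hcyc (h.tri j (by lia)) (h.tri (j + 1) (by lia))
    (h.tri (j + 2) hjk) (h.ne (by lia) (by lia) (by lia)) (h.ne (by lia) (by lia) (by lia)) he hx
    with rfl | rfl | rfl
  · exact ⟨j, by lia, rfl⟩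
  · exact ⟨j + 1, by lia, rfl⟩
  · exact ⟨j + 2, by lia, rfl⟩

/-- The edges at the last internal element of a tight path of length at least three that cannot be
extended: they belong to the path, unless the path has length three and there is a triangle that
contains the first and the last of its internal elements. -/
theorem exists_seqEdge_or_of_mem_last (h : S.IsTightSeq v (l + 3)) (hS : S.IsKConnected 3)
    (hV : 6 ≤ Fintype.card V) (hcyc : ¬ S.IsCyclic)
    (hmax : ∀ p, (∀ i ≤ l + 4, p ≠ v i) → ¬ S.Tri (v (l + 3)) (v (l + 4)) p)
    (he : e ∈ S.triangleHypergraph.edgeSet) (hx : v (l + 3) ∈ e) :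
    (∃ i < l + 3, e = seqEdge v i) ∨
      l = 0 ∧ ∃ p, p ≠ v 0 ∧ p ≠ v 2 ∧ p ≠ v 4 ∧ S.Tri (v 1) (v 3) p := by
  obtain ⟨a, b, hab, heq⟩ := exists_tri_of_mem he hx
  have T₁ := h.tri (l + 1) (by lia)
  have T₂ := h.tri (l + 2) (by lia)
  have hmem : ∀ y, y = a ∨ y = b → y ∈ e := by
    rintro y (rfl | rfl) <;> rw [heq] <;> simp
  by_cases h2 : v (l + 2) = a ∨ v (l + 2) = b
  · exact Or.inl (h.exists_seqEdge_of_mem hS hV hcyc (by lia) (by lia) he (hmem _ h2))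
  push Not at h2
  rcases T₁.reverse.mem_of_tri hS hV T₂.swap₁₂ (h.ne (by lia) (by lia) (by lia)) hab h2.1 h2.2
    with ⟨h1, h4, h4'⟩ | ⟨h4, h1, h1'⟩
  · rcases Nat.eq_zero_or_pos l with rfl | hl
    · refine Or.inr ⟨rfl, ?_⟩
      obtain ⟨c, hc, hcs, hcab⟩ := hab.exists_third h1
      refine ⟨c, ?_, ?_, ?_, hc.swap₁₂⟩
      · rintro rfl
        exact (h.tri 0 (by lia)).rotate.not_tri hS hV (h.tri 1 (by lia))
          (h.ne (by lia) (by lia) (by lia)) hc.rotate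
      · rintro rfl
        rcases hcab with e | e
        · exact h2.1 e
        · exact h2.2 e
      · rintro rfl
        rcases hcab with e | e
        · exact h4 e
        · exact h4' e
    · exact Or.inl (h.exists_seqEdge_of_mem hS hV hcyc (by lia) (by lia) he (hmem _ h1))
  · obtain ⟨c, hc, hcs, hcab⟩ := hab.exists_third h4
    by_cases hcv : ∃ i ≤ l + 4, c = v i
    · obtain ⟨i, hi, rfl⟩ := hcv
      have n1 : i ≠ l + 1 := by rintro rfl; tauto
      have n2 : i ≠ l + 2 := by rintro rfl; tauto
      have n3 : i ≠ l + 3 := by rintro rfl; exact hc.ne_ac rfl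
      have n4 : i ≠ l + 4 := by rintro rfl; exact hc.ne_bc rfl
      rcases Nat.lt_or_ge i 2 with hi2 | hi2
      · exfalso
        obtain rfl | rfl : i = 0 ∨ i = 1 := by lia
        · exact hcyc (h.isCyclic_of_closed hS (by lia) hc)
        · -- the edge meets both triangles `{v 0, v 1, v 2}` and `{v 1, v 2, v 3}` only in `v 1`
          have := (h.tri 0 (by lia)).rotate.mem_of_tri hS hV (h.tri 1 (by lia))
            (h.ne (by lia) (by lia) (by lia)) hc.rotate.rotate
            (h.ne (by lia) (by lia) (by lia)) (h.ne (by lia) (by lia) (by lia))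
          simp only [Nat.reduceAdd] at this
          rw [h.eq_iff (by lia) (by lia), h.eq_iff (by lia) (by lia), h.eq_iff (by lia) (by lia),
            h.eq_iff (by lia) (by lia)] at this
          lia
      · exact Or.inl (h.exists_seqEdge_of_mem hS hV hcyc hi2 (by lia) he (hmem _ hcab))
    · push Not at hcv
      exact absurd hc (hmax c hcv)

end IsTightSeq

end TightSeq

end IsotropicSystem

/-! ### Windmills, tripods, tables and ears -/

namespace IsotropicSystem

section Decomposition

variable {V : Type*} [Fintype V] [DecidableEq V] {S : IsotropicSystem V}
  {a b c p q r u v w x y z : V} {e : Set V}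

theorem eq_of_tri_of_tri (hS : S.IsKConnected 3) (hV : 5 ≤ Fintype.card V)
    (hx : S.IsNonessential x) (h : S.Tri x y p) (h' : S.Tri x y q) : p = q := by
  by_contra hpq
  exact not_isNonessential_of_tri_of_tri hS hV h h' hpq hx

/-- The form in which the triangle lemma shows that an element belongs to `N`. -/
theorem isNonessential_of_unique (hS : S.IsKConnected 3) (hV : 5 ≤ Fintype.card V)
    (h : S.Tri x a b) (ha : ¬ S.IsNonessential a) (h1 : ∀ p, S.Tri x a p → p = b)
    (h2 : ∀ p, S.Tri x b p → p = a) : S.IsNonessential x := by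
  by_contra hx
  rcases h.exists_tri hS hV hx ha with ⟨p, hp, hp'⟩ | ⟨p, hp, hp'⟩
  · exact hp (h1 p hp')
  · exact hp (h2 p hp')

/-- An edge without essential elements is a triangle, because the common elements of two edges that
meet in two elements are essential. -/
theorem isTriangle_of_subset (hS : S.IsKConnected 3) (hV : 5 ≤ Fintype.card V)
    (he : e ∈ S.triangleHypergraph.edgeSet) (heN : e ⊆ {x | S.IsNonessential x}) :
    S.triangleHypergraph.IsTriangle {x | S.IsNonessential x} (Hypergraph.generatedBy {e}) := by
  refine ⟨e, he, heN, ?_, rfl⟩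
  rintro ⟨e', he', h2⟩
  obtain ⟨x, y, hxy, hee⟩ := Set.ncard_eq_two.1 h2
  have hx : x ∈ e ∩ e' := by rw [hee]; simp
  have hy : y ∈ e ∩ e' := by rw [hee]; simp
  obtain ⟨a, b, hab, rfl⟩ := exists_tri_of_mem he hx.1
  obtain ⟨a', b', hab', rfl⟩ := exists_tri_of_mem he' hx.2
  obtain ⟨c, hc, hcs, -⟩ := hab.exists_third (y := y) (by
    rcases hy.1 with h | h | h
    · exact absurd h.symm hxy
    · exact Or.inl h
    · exact Or.inr h)
  obtain ⟨c', hc', hcs', -⟩ := hab'.exists_third (y := y) (by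
    rcases hy.2 with h | h | h
    · exact absurd h.symm hxy
    · exact Or.inl h
    · exact Or.inr h)
  obtain rfl := eq_of_tri_of_tri hS hV (heN hx.1) hc hc'
  rw [hcs, hcs', Set.inter_self, ncard_triple hc.ne_ab hc.ne_ac hc.ne_bc] at h2
  lia

/-- If `v` is the only essential element of a triangle, then all triangles through `v` have this
property: by the triangle lemma, a second essential element of a triangle through `v` leads to two
triangles that share `v` and an essential element, one of which meets the given triangle in two
elements. -/
theorem Tri.isNonessential_of_tri (hS : S.IsKConnected 3) (hV : 6 ≤ Fintype.card V)
    (h : S.Tri v a b) (hv : ¬ S.IsNonessential v) (ha : S.IsNonessential a)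
    (hb : S.IsNonessential b) (h' : S.Tri v p q) : S.IsNonessential p := by
  by_contra hp
  have hpa : p ≠ a := by rintro rfl; exact hp ha
  have hpb : p ≠ b := by rintro rfl; exact hp hb
  have key : ∀ y z, S.Tri v y z → y ≠ a → y ≠ b → z ≠ a ∧ z ≠ b := by
    intro y z hz hya hyb
    refine ⟨?_, ?_⟩ <;> rintro rfl
    · exact hyb (eq_of_tri_of_tri hS (by lia) ha hz.rotate.rotate h.swap₁₂)
    · exact hya (eq_of_tri_of_tri hS (by lia) hb hz.rotate.rotate h.rotate.rotate)
  have k1 := key p q h' hpa hpb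
  rcases h'.exists_tri hS (by lia) hv hp with ⟨r, hr, hr'⟩ | ⟨r, hr, hr'⟩
  · have k2 := key p r hr' hpa hpb
    have := h'.mem_of_tri hS hV hr' hr.symm h hpa hpb
    tauto
  · have k2 := key q r hr' k1.1 k1.2
    have := h'.swap.mem_of_tri hS hV hr' hr.symm h k1.1 k1.2
    tauto

theorem isWindmill_of_tri (hS : S.IsKConnected 3) (hV : 6 ≤ Fintype.card V)
    (h : S.Tri v a b) (hv : ¬ S.IsNonessential v) (ha : S.IsNonessential a)
    (hb : S.IsNonessential b) :
    S.triangleHypergraph.IsWindmill {x | S.IsNonessential x}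
      (Hypergraph.generatedBy {e | e ∈ S.triangleHypergraph.edgeSet ∧ v ∈ e}) := by
  have hN : ∀ p q, S.Tri v p q → S.IsNonessential p ∧ S.IsNonessential q := fun p q h' =>
    ⟨h.isNonessential_of_tri hS hV hv ha hb h', h.isNonessential_of_tri hS hV hv ha hb h'.swap⟩
  refine ⟨v, ⟨trivial, hv⟩, _, rfl, ⟨_, h.mem_edgeSet, by simp⟩, ?_, ?_, rfl⟩
  · rintro e ⟨he, hve⟩
    obtain ⟨p, q, hpq, rfl⟩ := exists_tri_of_mem he hve
    obtain ⟨hp, hq⟩ := hN p q hpq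
    refine ⟨?_, fun e' he' hsub => ?_⟩
    · rintro x ⟨rfl | rfl | rfl, hx⟩
      · exact absurd rfl hx
      · exact hp
      · exact hq
    · have hpe : p ∈ e' := hsub ⟨by simp, hpq.ne_ab.symm⟩
      have hqe : q ∈ e' := hsub ⟨by simp, hpq.ne_ac.symm⟩
      obtain ⟨c, d, hcd, rfl⟩ := exists_tri_of_mem he' hpe
      obtain ⟨r, hr, hrs, -⟩ := hcd.exists_third (y := q) (by
        rcases hqe with h | h | h
        · exact absurd h.symm hpq.ne_bc
        · exact Or.inl h
        · exact Or.inr h)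
      obtain rfl := eq_of_tri_of_tri hS (by lia) hp hr hpq.rotate
      rw [hrs]
      grind
  · rintro e ⟨he, hve⟩ e' ⟨he', hve'⟩ hne
    obtain ⟨p, q, hpq, rfl⟩ := exists_tri_of_mem he hve
    obtain ⟨hp, hq⟩ := hN p q hpq
    refine Set.Subset.antisymm ?_ (Set.singleton_subset_iff.2 ⟨hve, hve'⟩)
    rintro x ⟨hx, hx'⟩
    by_contra hxv
    refine hne ?_
    obtain ⟨c, d, hcd, rfl⟩ := exists_tri_of_mem he' hve'
    obtain ⟨r, hr, hrs, -⟩ := hpq.exists_third (y := x) (hx.resolve_left hxv)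
    obtain ⟨s, hs, hss, -⟩ := hcd.exists_third (y := x) (hx'.resolve_left hxv)
    rw [hrs, hss, eq_of_tri_of_tri hS (by lia) (hN _ _ hr).1 hr.swap₁₂ hs.swap₁₂]

/-- Three triangles that contain the pair `u`, `v` form a tripod, as every edge through `u` or `v`
is one of them. -/
theorem isTripod_of_three_tri (hS : S.IsKConnected 3) (hV : 6 ≤ Fintype.card V)
    (h₁ : S.Tri u v p) (h₂ : S.Tri u v q) (h₃ : S.Tri u v r) (hpq : p ≠ q) (hpr : p ≠ r)
    (hqr : q ≠ r) :
    S.triangleHypergraph.IsTripod {x | S.IsNonessential x}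
      (Hypergraph.generatedBy {e | e ∈ S.triangleHypergraph.edgeSet ∧ (u ∈ e ∨ v ∈ e)}) := by
  have hu : ¬ S.IsNonessential u := not_isNonessential_of_tri_of_tri hS (by lia) h₁ h₂ hpq
  have hv : ¬ S.IsNonessential v :=
    not_isNonessential_of_tri_of_tri hS (by lia) h₁.swap₁₂ h₂.swap₁₂ hpq
  have hmemu : ∀ a b, S.Tri u a b → v = a ∨ v = b := fun a b h =>
    h₁.mem_of_three_tri hS hV h₂ h₃ hpq hpr hqr h
  have hmemv : ∀ a b, S.Tri v a b → u = a ∨ u = b := fun a b h =>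
    h₁.swap₁₂.mem_of_three_tri hS hV h₂.swap₁₂ h₃.swap₁₂ hpq hpr hqr h
  have hN : ∀ x, S.Tri u v x → S.IsNonessential x := fun x hx => by
    refine isNonessential_of_unique hS (by lia) hx.rotate.rotate hu (fun z hz => ?_) fun z hz => ?_
    · exact ((hmemu _ _ hz.swap₁₂).resolve_left hx.ne_bc).symm
    · exact ((hmemv _ _ hz.swap₁₂).resolve_left hx.ne_ac).symm
  have hX : {e | e ∈ S.triangleHypergraph.edgeSet ∧ (u ∈ e ∨ v ∈ e)} =
      {{u, v, p}, {u, v, q}, {u, v, r}} := by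
    ext e
    constructor
    · rintro ⟨he, hue⟩
      obtain ⟨x, hx, rfl⟩ : ∃ x, S.Tri u v x ∧ e = {u, v, x} := by
        rcases hue with hue | hue
        · obtain ⟨a, b, hab, rfl⟩ := exists_tri_of_mem he hue
          obtain ⟨c, hc, hcs, -⟩ := hab.exists_third (hmemu _ _ hab)
          exact ⟨c, hc, hcs⟩
        · obtain ⟨a, b, hab, rfl⟩ := exists_tri_of_mem he hue
          obtain ⟨c, hc, hcs, -⟩ := hab.exists_third (hmemv _ _ hab)
          exact ⟨c, hc.swap₁₂, hcs.trans (Set.insert_comm _ _ _)⟩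
      rcases Tri.eq_of_three_tri hS (by lia) h₁ h₂ h₃ hpq hpr hqr hx with rfl | rfl | rfl <;> simp
    · rintro (rfl | rfl | rfl)
      · exact ⟨h₁.mem_edgeSet, by simp⟩
      · exact ⟨h₂.mem_edgeSet, by simp⟩
      · exact ⟨h₃.mem_edgeSet, by simp⟩
  have hne : ∀ x y, S.Tri u v x → x ≠ y → ({u, v, x} : Set V) ≠ {u, v, y} := by
    intro x y hx hxy he
    have : x ∈ ({u, v, y} : Set V) := he ▸ (by simp)
    rcases this with h | h | h
    · exact hx.ne_ac h.symm
    · exact hx.ne_bc h.symm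
    · exact hxy h
  refine ⟨u, ⟨trivial, hu⟩, v, ⟨trivial, hv⟩, h₁.ne_ab, _, rfl, ?_, ?_, rfl⟩
  · rw [hX]
    exact ncard_triple (hne _ _ h₁ hpq) (hne _ _ h₁ hpr) (hne _ _ h₂ hqr)
  · have : ∀ x, S.Tri u v x → ({u, v} : Set V) ⊆ {u, v, x} ∧
        ({u, v, x} : Set V) ⊆ {x | S.IsNonessential x} ∪ {u, v} := fun x hx => by
      refine ⟨by grind, ?_⟩
      rintro z (rfl | rfl | rfl)
      · simp
      · simp
      · exact Or.inl (hN _ hx)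
    rw [hX]
    rintro e (rfl | rfl | rfl)
    · exact this _ h₁
    · exact this _ h₂
    · exact this _ h₃

theorem isNonessential_of_table (hS : S.IsKConnected 3) (hV : 6 ≤ Fintype.card V)
    (hcyc : ¬ S.IsCyclic) (h : S.Tri a b c) (hx : S.Tri a b x) (hy : S.Tri b c y)
    (hz : S.Tri a c z) (hxc : x ≠ c) (hya : y ≠ a) (hzb : z ≠ b) (hxy : x ≠ y) (hxz : x ≠ z) :
    S.IsNonessential x := by
  refine isNonessential_of_unique hS (by lia) hx.rotate.rotate
    (not_isNonessential_of_tri_of_tri hS (by lia) h hx hxc.symm) (fun w hw => ?_) fun w hw => ?_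
  · have e := eq_of_mem_of_table hS hV hcyc h hx hz hxc hzb hw.mem_edgeSet (by simp)
    have hxe : x ∈ ({x, a, w} : Set V) := by simp
    have hwe : w ∈ ({x, a, w} : Set V) := by simp
    rcases e with e | e | e <;> rw [e] at hxe hwe
    · simp [hx.ne_ac.symm, hx.ne_bc.symm, hxc] at hxe
    · simpa [hw.ne_bc.symm, hw.ne_ac.symm] using hwe
    · simp [hx.ne_ac.symm, hxc, hxz] at hxe
  · have e := eq_of_mem_of_table hS hV hcyc h.swap₁₂ hx.swap₁₂ hy hxc hya hw.mem_edgeSet (by simp)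
    have hxe : x ∈ ({x, b, w} : Set V) := by simp
    have hwe : w ∈ ({x, b, w} : Set V) := by simp
    rcases e with e | e | e <;> rw [e] at hxe hwe
    · simp [hx.ne_ac.symm, hx.ne_bc.symm, hxc] at hxe
    · simpa [hw.ne_bc.symm, hw.ne_ac.symm] using hwe
    · simp [hx.ne_bc.symm, hxc, hxy] at hxe

/-- A triangle `{a, b, c}` and three further triangles, each containing a different pair from it,
form a table. -/
theorem isTable_of_tri (hS : S.IsKConnected 3) (hV : 6 ≤ Fintype.card V) (hcyc : ¬ S.IsCyclic)
    (h : S.Tri a b c) (hx : S.Tri a b x) (hy : S.Tri b c y) (hz : S.Tri a c z)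
    (hxc : x ≠ c) (hya : y ≠ a) (hzb : z ≠ b) (hxy : x ≠ y) (hxz : x ≠ z) (hyz : y ≠ z) :
    S.triangleHypergraph.IsTable {x | S.IsNonessential x}
      (Hypergraph.generatedBy
        {e | e ∈ S.triangleHypergraph.edgeSet ∧ (e ∩ {a, b, c}).Nonempty}) := by
  have ha : ¬ S.IsNonessential a := not_isNonessential_of_tri_of_tri hS (by lia) h hx hxc.symm
  have hb : ¬ S.IsNonessential b :=
    not_isNonessential_of_tri_of_tri hS (by lia) h.swap₁₂ hx.swap₁₂ hxc.symm
  have hc : ¬ S.IsNonessential c :=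
    not_isNonessential_of_tri_of_tri hS (by lia) h.reverse hy.swap₁₂ hya.symm
  have hxN : S.IsNonessential x :=
    isNonessential_of_table hS hV hcyc h hx hy hz hxc hya hzb hxy hxz
  have hyN : S.IsNonessential y :=
    isNonessential_of_table hS hV hcyc h.rotate hy hz.swap₁₂ hx.swap₁₂ hya hzb hxc hyz hxy.symm
  have hzN : S.IsNonessential z :=
    isNonessential_of_table hS hV hcyc h.swap hz hy.swap₁₂ hx hzb hya hxc hyz.symm hxz.symm
  have rot : ({b, c, a} : Set V) = {a, b, c} := by grind
  have rot' : ({c, a, b} : Set V) = {a, b, c} := by grind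
  have swp : ({b, a, x} : Set V) = {a, b, x} := Set.insert_comm _ _ _
  have swp' : ({c, a, z} : Set V) = {a, c, z} := Set.insert_comm _ _ _
  have swp'' : ({c, b, y} : Set V) = {b, c, y} := Set.insert_comm _ _ _
  have hX : {e | e ∈ S.triangleHypergraph.edgeSet ∧ (e ∩ {a, b, c}).Nonempty} =
      {{a, b, c}, {a, b, x}, {b, c, y}, {a, c, z}} := by
    ext e
    simp only [Set.mem_insert_iff, Set.mem_singleton_iff]
    constructor
    · rintro ⟨he, w, hw, hw'⟩
      rcases hw' with rfl | rfl | rfl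
      · have := eq_of_mem_of_table hS hV hcyc h hx hz hxc hzb he hw
        tauto
      · have := eq_of_mem_of_table hS hV hcyc h.rotate hy hx.swap₁₂ hya hxc he hw
        rw [rot, swp] at this
        tauto
      · have := eq_of_mem_of_table hS hV hcyc h.rotate.rotate hz.swap₁₂ hy.swap₁₂ hzb hya he hw
        rw [rot', swp', swp''] at this
        tauto
    · rintro (rfl | rfl | rfl | rfl)
      · exact ⟨h.mem_edgeSet, a, by simp⟩
      · exact ⟨hx.mem_edgeSet, a, by simp⟩
      · exact ⟨hy.mem_edgeSet, b, by simp⟩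
      · exact ⟨hz.mem_edgeSet, a, by simp⟩
  have aux : ∀ {p q w : V}, p ∈ ({a, b, c} : Set V) → q ∈ ({a, b, c} : Set V) →
      w ∉ ({a, b, c} : Set V) → ({p, q, w} : Set V) \ {a, b, c} = {w} := by
    intro p q w hp hq hw
    rw [Set.insert_sdiff_of_mem _ hp, Set.insert_sdiff_of_mem _ hq]
    exact sdiff_eq_left.2 (Set.disjoint_singleton_left.2 hw)
  have d0 : ({a, b, c} : Set V) \ {a, b, c} = ∅ := Set.sdiff_self
  have d1 : ({a, b, x} : Set V) \ {a, b, c} = {x} :=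
    aux (by simp) (by simp) (by simp [hx.ne_ac.symm, hx.ne_bc.symm, hxc])
  have d2 : ({b, c, y} : Set V) \ {a, b, c} = {y} :=
    aux (by simp) (by simp) (by simp [hy.ne_ac.symm, hy.ne_bc.symm, hya])
  have d3 : ({a, c, z} : Set V) \ {a, b, c} = {z} :=
    aux (by simp) (by simp) (by simp [hz.ne_ac.symm, hz.ne_bc.symm, hzb])
  have hinj : Set.InjOn (fun e : Set V => e \ {a, b, c})
      {{a, b, c}, {a, b, x}, {b, c, y}, {a, c, z}} := by
    have n1 := hxy.symm
    have n2 := hxz.symm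
    have n3 := hyz.symm
    rintro e (rfl | rfl | rfl | rfl) e' (rfl | rfl | rfl | rfl) hee <;>
      simp_all only [Set.singleton_eq_singleton_iff, Set.singleton_ne_empty,
        Set.empty_ne_singleton]
  refine ⟨{a, b, c}, h.mem_edgeSet, ?_, _, rfl, ?_, ?_, ?_, rfl⟩
  · rintro w (rfl | rfl | rfl)
    · exact ⟨trivial, ha⟩
    · exact ⟨trivial, hb⟩
    · exact ⟨trivial, hc⟩
  · rw [hX, ← hinj.ncard_image]
    simp only [Set.image_insert_eq, Set.image_singleton, d0, d1, d2, d3]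
    rw [Set.ncard_insert_of_notMem, ncard_triple]
    · simpa using hxy
    · simpa using hxz
    · simpa using hyz
    · simp
  · rw [hX]
    rintro e (rfl | rfl | rfl | rfl)
    · rw [d0]
      exact ⟨two_le_ncard_of_mem (a := a) (b := b) (by simp) (by simp) h.ne_ab,
        Set.empty_subset _⟩
    · rw [d1]
      exact ⟨two_le_ncard_of_mem (a := a) (b := b) (by simp) (by simp) h.ne_ab,
        Set.singleton_subset_iff.2 hxN⟩
    · rw [d2]
      exact ⟨two_le_ncard_of_mem (a := b) (b := c) (by simp) (by simp) h.ne_bc,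
        Set.singleton_subset_iff.2 hyN⟩
    · rw [d3]
      exact ⟨two_le_ncard_of_mem (a := a) (b := c) (by simp) (by simp) h.ne_ac,
        Set.singleton_subset_iff.2 hzN⟩
  · rw [hX]
    exact fun e he e' he' hne hd => hne (hinj he he' hd)

variable {v : ℕ → V} {k : ℕ}

namespace IsTightSeq

theorem isNonessential_zero (h : S.IsTightSeq v k) (hS : S.IsKConnected 3)
    (hV : 5 ≤ Fintype.card V) (hk : 2 ≤ k)
    (hclean : ∀ j, 1 ≤ j → j ≤ k → ∀ e ∈ S.triangleHypergraph.edgeSet, v j ∈ e →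
      ∃ i < k, e = seqEdge v i) : S.IsNonessential (v 0) := by
  have T := h.tri 0 (by lia)
  have T' := h.tri 1 (by lia)
  have h1 : ¬ S.IsNonessential (v 1) := not_isNonessential_of_tri_of_tri hS hV T.rotate T'
    (h.ne (by lia) (by lia) (by lia))
  have aux : ∀ j p, 1 ≤ j → j ≤ k → S.Tri (v 0) (v j) p → p ∈ seqEdge v 0 := by
    intro j p h1 h2 hp
    obtain ⟨i, hi, he⟩ := hclean j h1 h2 _ hp.mem_edgeSet (by simp)
    have h0 : v 0 ∈ seqEdge v i := he ▸ (by simp)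
    rw [h.mem_seqEdge hi (by lia)] at h0
    obtain rfl : i = 0 := by lia
    exact he ▸ (by simp)
  refine isNonessential_of_unique hS hV T h1 (fun p hp => ?_) fun p hp => ?_
  · rcases aux 1 p (by lia) (by lia) hp with e | e | e
    · exact absurd e.symm hp.ne_ac
    · exact absurd e.symm hp.ne_bc
    · exact e
  · rcases aux 2 p (by lia) (by lia) hp with e | e | e
    · exact absurd e.symm hp.ne_ac
    · exact e
    · exact absurd e.symm hp.ne_bc

/-- A tight path of length at least two whose internal elements are only in edges of the path is an
ear: by the triangle lemma, an essential end would lead to a further edge. -/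
theorem isEar (h : S.IsTightSeq v k) (hS : S.IsKConnected 3) (hV : 5 ≤ Fintype.card V)
    (hk : 2 ≤ k) (hclean : ∀ j, 1 ≤ j → j ≤ k → ∀ e ∈ S.triangleHypergraph.edgeSet, v j ∈ e →
      ∃ i < k, e = seqEdge v i) :
    S.triangleHypergraph.IsEar {x | S.IsNonessential x} (seqPath v k) := by
  have h0 := h.isNonessential_zero hS hV hk hclean
  have hlast := h.reverse.isNonessential_zero hS hV hk fun j h1 h2 e he hje =>
    exists_seqEdge_reverse.2 (hclean (k + 1 - j) (by lia) (by lia) e he hje)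
  have hint : ∀ x, (seqPath v k).IsInternal x → ∃ j, 1 ≤ j ∧ j ≤ k ∧ x = v j := by
    rintro _ ⟨⟨j, hj, rfl⟩, _, ⟨a, ha, rfl⟩, _, ⟨b, hb, rfl⟩, hne, hja, hjb⟩
    simp only [Set.mem_Iic] at hj
    rw [h.mem_seqEdge ha hj] at hja
    rw [h.mem_seqEdge hb hj] at hjb
    have : a ≠ b := by rintro rfl; exact hne rfl
    exact ⟨j, by lia, by lia, rfl⟩
  refine ⟨⟨k, hk, by lia, ⟨Set.subset_univ _, ?_⟩, fun i => v i, ?_, ?_, ?_⟩, ?_, ?_, ?_⟩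
  · rintro _ ⟨i, hi, rfl⟩
    exact (h.tri i hi).mem_edgeSet
  · exact fun i j hij => Fin.ext ((h.eq_iff (by lia) (by lia)).1 hij)
  · ext x
    constructor
    · rintro ⟨j, hj, rfl⟩
      simp only [Set.mem_Iic] at hj
      exact ⟨⟨j, by lia⟩, rfl⟩
    · rintro ⟨j, rfl⟩
      exact ⟨j, by simp only [Set.mem_Iic]; lia, rfl⟩
  · ext e
    constructor
    · rintro ⟨i, hi, rfl⟩
      exact ⟨⟨i, hi⟩, rfl⟩
    · rintro ⟨i, rfl⟩
      exact ⟨i, i.2, rfl⟩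
  · rintro _ ⟨⟨j, hj, rfl⟩, hex⟩
    simp only [Set.mem_Iic] at hj
    by_cases hj0 : j = 0
    · exact hj0 ▸ h0
    by_cases hjk : j = k + 1
    · exact hjk ▸ hlast
    exfalso
    -- an internal element is in two edges of the path
    have two : ∀ a b, a < k → b < k → a ≠ b → a ≤ j → j ≤ a + 2 → b ≤ j → j ≤ b + 2 → False := by
      intro a b ha hb hab h1 h2 h3 h4
      have heq := hex.unique ⟨⟨a, ha, rfl⟩, (h.mem_seqEdge ha hj).2 ⟨h1, h2⟩⟩
        ⟨⟨b, hb, rfl⟩, (h.mem_seqEdge hb hj).2 ⟨h3, h4⟩⟩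
      have m1 : v a ∈ seqEdge v b := heq ▸ (h.mem_seqEdge ha (by lia)).2 (by lia)
      have m2 : v b ∈ seqEdge v a := heq ▸ (h.mem_seqEdge hb (by lia)).2 (by lia)
      rw [h.mem_seqEdge hb (by lia)] at m1
      rw [h.mem_seqEdge ha (by lia)] at m2
      lia
    by_cases hj1 : j = 1
    · exact two 0 1 (by lia) (by lia) (by lia) (by lia) (by lia) (by lia) (by lia)
    · exact two (j - 2) (j - 1) (by lia) (by lia) (by lia) (by lia) (by lia) (by lia) (by lia)
  · intro x hx
    obtain ⟨j, h1, h2, rfl⟩ := hint x hx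
    obtain ⟨j, rfl⟩ := Nat.exists_eq_add_of_le' h1
    have T := h.tri j (by lia)
    by_cases hjk : j + 1 < k
    · exact not_isNonessential_of_tri_of_tri hS hV T.rotate (h.tri (j + 1) hjk)
        (h.ne (by lia) (by lia) (by lia))
    · obtain ⟨i, rfl⟩ : ∃ i, j = i + 1 := ⟨j - 1, by lia⟩
      exact not_isNonessential_of_tri_of_tri hS hV T.swap₁₂ (h.tri i (by lia)).reverse
        (h.ne (by lia) (by lia) (by lia))
  · intro e he hne x hx hxe
    obtain ⟨j, h1, h2, rfl⟩ := hint x hx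
    exact hne (hclean j h1 h2 e he hxe)

end IsTightSeq

end Decomposition

end IsotropicSystem

/-! ### Maximal tight paths -/

namespace IsotropicSystem

section MaximalPath

variable {V : Type*} [Fintype V] {S : IsotropicSystem V} {a b c d p : V} {e e' : Set V}
  {v : ℕ → V} {k : ℕ}

/-- The sequence `a, b, c, d, d, d, …`. -/
def seqFour (a b c d : V) : ℕ → V
  | 0 => a
  | 1 => b
  | 2 => c
  | _ => d

theorem isTightSeq_seqFour (h : S.Tri a b c) (h' : S.Tri b c d) (had : a ≠ d) :
    S.IsTightSeq (seqFour a b c d) 2 := by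
  have h1 := h.ne_ab
  have h2 := h.ne_ac
  have h3 := h.ne_bc
  have h4 := h'.ne_ac
  have h5 := h'.ne_bc
  refine ⟨fun i hi j hj hij => ?_, fun i hi => ?_⟩
  · simp only [Set.mem_Iic] at hi hj
    interval_cases i <;> interval_cases j <;> simp only [seqFour] at hij <;>
      first | rfl | exact absurd hij (by assumption) | exact absurd hij.symm (by assumption)
  · interval_cases i
    · exact h
    · exact h'

/-- Some tight path of length `k` contains the edge `e`. -/
def IsInTightSeq (S : IsotropicSystem V) (e : Set V) (k : ℕ) : Prop :=
  ∃ v, S.IsTightSeq v k ∧ ∃ i < k, e = seqEdge v i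

/-- Since a tight path of length `k` has `k + 2` elements, lengths cannot increase indefinitely. -/
theorem exists_maximal_isInTightSeq (h : S.IsInTightSeq e k) :
    ∃ l, k ≤ l ∧ S.IsInTightSeq e l ∧ ¬ S.IsInTightSeq e (l + 1) := by
  by_contra! hno
  have hall : ∀ n, S.IsInTightSeq e (k + n) := fun n => by
    induction n with
    | zero => exact h
    | succ n ih => exact hno _ (by lia) ih
  obtain ⟨v, hv, -⟩ := hall (Fintype.card V)
  have := hv.le_card
  lia

theorem IsTightSeq.not_tri_of_maximal (h : S.IsTightSeq v k) (he : ∃ i < k, e = seqEdge v i)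
    (hmax : ¬ S.IsInTightSeq e (k + 1)) (hp : ∀ i ≤ k + 1, p ≠ v i) :
    ¬ S.Tri (v k) (v (k + 1)) p := by
  intro htri
  obtain ⟨i, hi, rfl⟩ := he
  exact hmax ⟨_, h.extend hp htri, i, by lia, (seqEdge_update hi).symm⟩

/-- The edges at the last internal element of a tight path of length two that is not contained in a
longer one, where the pair of internal elements is in no third edge. If such an edge contains the
first element of the path, the path extends after interchanging its ends. -/
theorem IsTightSeq.exists_seqEdge_of_mem_two (h : S.IsTightSeq v 2) (hS : S.IsKConnected 3)
    (hV : 6 ≤ Fintype.card V) (he : ∃ i < 2, e = seqEdge v i) (hmax : ¬ S.IsInTightSeq e 3)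
    (htwo : ∀ r, S.Tri (v 2) (v 1) r → r = v 0 ∨ r = v 3)
    (he' : e' ∈ S.triangleHypergraph.edgeSet) (hx : v 2 ∈ e') : ∃ i < 2, e' = seqEdge v i := by
  obtain ⟨a, b, hab, rfl⟩ := exists_tri_of_mem he' hx
  have T₁ := h.tri 0 (by lia)
  have T₂ := h.tri 1 (by lia)
  have h03 : v 0 ≠ v 3 := h.ne (by lia) (by lia) (by lia)
  by_cases h1 : v 1 = a ∨ v 1 = b
  · obtain ⟨c, hc, hcs, -⟩ := hab.exists_third h1
    rcases htwo c hc with rfl | rfl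
    · exact ⟨0, by lia, by rw [hcs]; simp only [seqEdge]; grind⟩
    · exact ⟨1, by lia, by rw [hcs]; simp only [seqEdge]; grind⟩
  push Not at h1
  exfalso
  rcases T₁.reverse.mem_of_tri hS hV T₂.swap₁₂ h03 hab h1.1 h1.2
    with ⟨h0, h3, h3'⟩ | ⟨h3, h0, h0'⟩
  · obtain ⟨c, hc, hcs, hcab⟩ := hab.exists_third h0
    refine (isTightSeq_seqFour T₂.rotate.rotate T₁.rotate h03.symm).not_tri_of_maximal
      (e := e) ?_ hmax ?_ hc
    · obtain ⟨i, hi, rfl⟩ := he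
      interval_cases i
      · exact ⟨1, by lia, by simp only [seqEdge, seqFour]; grind⟩
      · exact ⟨0, by lia, by simp only [seqEdge, seqFour]; grind⟩
    · intro i hi
      have := hc.ne_ac
      have := hc.ne_bc
      interval_cases i <;> simp only [seqFour] <;> grind
  · obtain ⟨c, hc, hcs, hcab⟩ := hab.exists_third h3
    refine h.not_tri_of_maximal he hmax (p := c) ?_ hc
    intro i hi
    have := hc.ne_ac
    have := hc.ne_bc
    interval_cases i <;> grind

end MaximalPath

section Main

variable {V : Type*} [Fintype V] [DecidableEq V] {S : IsotropicSystem V} {a b x : V} {e : Set V}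

/-- An edge on a tight path of length two lies in an ear, a tripod or a table. These arise from a
tight path containing the edge that is not contained in a longer one. -/
theorem exists_of_isInTightSeq (hS : S.IsKConnected 3) (hV : 6 ≤ Fintype.card V)
    (hcyc : ¬ S.IsCyclic) (h : S.IsInTightSeq e 2) :
    ∃ P, (S.triangleHypergraph.IsEar {x | S.IsNonessential x} P ∨
      S.triangleHypergraph.IsTripod {x | S.IsNonessential x} P ∨
      S.triangleHypergraph.IsTable {x | S.IsNonessential x} P) ∧ e ∈ P.edgeSet := by
  obtain ⟨k, hk, ⟨v, hv, hev⟩, hmax⟩ := exists_maximal_isInTightSeq h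
  have heE : e ∈ S.triangleHypergraph.edgeSet := by
    obtain ⟨i, hi, rfl⟩ := hev
    exact (hv.tri i hi).mem_edgeSet
  have hrev := hv.reverse
  have herev := exists_seqEdge_reverse.2 hev
  obtain rfl | hk3 : k = 2 ∨ 3 ≤ k := by lia
  · by_cases htwo : ∃ r, S.Tri (v 1) (v 2) r ∧ r ≠ v 0 ∧ r ≠ v 3
    · obtain ⟨r, hr, hr0, hr3⟩ := htwo
      refine ⟨_, Or.inr (Or.inl (isTripod_of_three_tri hS hV (hv.tri 0 (by lia)).rotate
        (hv.tri 1 (by lia)) hr (hv.ne (by lia) (by lia) (by lia)) hr0.symm hr3.symm)), heE, ?_⟩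
      obtain ⟨i, hi, rfl⟩ := hev
      exact Or.inl ((hv.mem_seqEdge hi (by lia)).2 (by lia))
    · have htwo' : ∀ r, S.Tri (v 1) (v 2) r → r = v 0 ∨ r = v 3 := fun r hr => by
        by_contra! hne
        exact htwo ⟨r, hr, hne⟩
      refine ⟨_, Or.inl (hv.isEar hS (by lia) le_rfl fun j h1 h2 e' he' hj => ?_), hev⟩
      obtain rfl | rfl : j = 1 ∨ j = 2 := by lia
      · exact exists_seqEdge_reverse.1 (hrev.exists_seqEdge_of_mem_two hS hV herev hmax
          (fun r hr => (htwo' r hr).symm) he' hj)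
      · exact hv.exists_seqEdge_of_mem_two hS hV hev hmax (fun r hr => htwo' r hr.swap₁₂) he' hj
  obtain ⟨l, rfl⟩ := Nat.exists_eq_add_of_le' hk3
  by_cases htab : l = 0 ∧ ∃ p, p ≠ v 0 ∧ p ≠ v 2 ∧ p ≠ v 4 ∧ S.Tri (v 1) (v 3) p
  · obtain ⟨rfl, p, h0, h2, h4, hp⟩ := htab
    refine ⟨_, Or.inr (Or.inr (isTable_of_tri hS hV hcyc (hv.tri 1 (by lia))
      (hv.tri 0 (by lia)).rotate (hv.tri 2 (by lia)) hp (hv.ne (by lia) (by lia) (by lia))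
      (hv.ne (by lia) (by lia) (by lia)) h2 (hv.ne (by lia) (by lia) (by lia)) h0.symm h4.symm)),
      heE, v 2, ?_, by simp⟩
    obtain ⟨i, hi, rfl⟩ := hev
    exact (hv.mem_seqEdge hi (by lia)).2 (by lia)
  · refine ⟨_, Or.inl (hv.isEar hS (by lia) (by lia) fun j h1 h2 e' he' hj => ?_), hev⟩
    by_cases hj1 : j = 1
    · subst hj1
      refine exists_seqEdge_reverse.1 ((hrev.exists_seqEdge_or_of_mem_last hS hV hcyc
        (fun p hp => hrev.not_tri_of_maximal herev hmax hp) he' ?_).resolve_right ?_)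
      · rwa [show l + 3 + 1 - (l + 3) = 1 by lia]
      · rintro ⟨rfl, p, h0, h2, h4, hp⟩
        exact htab ⟨rfl, p, h4, h2, h0, hp.swap₁₂⟩
    by_cases hjk : j = l + 3
    · subst hjk
      exact (hv.exists_seqEdge_or_of_mem_last hS hV hcyc
        (fun p hp => hv.not_tri_of_maximal hev hmax hp) he' hj).resolve_right htab
    · exact hv.exists_seqEdge_of_mem hS hV hcyc (by lia) (by lia) he' hj

theorem Tri.isInTightSeq (hS : S.IsKConnected 3) (hV : 6 ≤ Fintype.card V) (h : S.Tri x a b)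
    (hx : ¬ S.IsNonessential x) (ha : ¬ S.IsNonessential a) : S.IsInTightSeq {x, a, b} 2 := by
  rcases h.exists_tri hS (by lia) hx ha with ⟨p, hp, hp'⟩ | ⟨p, hp, hp'⟩
  · exact ⟨_, isTightSeq_seqFour h.rotate.rotate hp' hp.symm, 0, by lia,
      by simp only [seqEdge, seqFour]; grind⟩
  · exact ⟨_, isTightSeq_seqFour h.swap₁₂ hp' hp.symm, 0, by lia,
      by simp only [seqEdge, seqFour]; grind⟩

end Main

end IsotropicSystem

theorem mainTheorem5 {V : Type*} [Fintype V] [DecidableEq V] (S : IsotropicSystem V)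
    (hconn : S.IsKConnected 3) (hcard : 5 ≤ Fintype.card V) (hcyc : ¬ S.IsCyclic)
    (N : Set V) (hN : N = {v | S.IsNonessential v}) :
    S.triangleHypergraph.edgeSet =
      ⋃ P ∈ {P : Hypergraph V |
          S.triangleHypergraph.IsEar N P ∨ S.triangleHypergraph.IsTriangle N P ∨
          S.triangleHypergraph.IsWindmill N P ∨ S.triangleHypergraph.IsTripod N P ∨
          S.triangleHypergraph.IsTable N P}, P.edgeSet := by
  have hV : 6 ≤ Fintype.card V := by
    by_contra hlt
    exact hcyc (IsotropicSystem.isCyclic_of_card_eq_five hconn (by lia))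
  subst hN
  apply Set.Subset.antisymm
  · intro e he
    simp only [Set.mem_iUnion, exists_prop]
    by_cases heN : e ⊆ {v | S.IsNonessential v}
    · exact ⟨_, Or.inr (Or.inl (IsotropicSystem.isTriangle_of_subset hconn hcard he heN)), rfl⟩
    obtain ⟨x, hxe, hx⟩ := Set.not_subset.1 heN
    obtain ⟨a, b, hab, rfl⟩ := IsotropicSystem.exists_tri_of_mem he hxe
    by_cases hN : S.IsNonessential a ∧ S.IsNonessential b
    · exact ⟨_, Or.inr (Or.inr (Or.inl
        (IsotropicSystem.isWindmill_of_tri hconn hV hab hx hN.1 hN.2))), he, hxe⟩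
    have hseq : S.IsInTightSeq {x, a, b} 2 := by
      by_cases ha : S.IsNonessential a
      · rw [Set.pair_comm]
        exact hab.swap.isInTightSeq hconn hV hx fun hb => hN ⟨ha, hb⟩
      · exact hab.isInTightSeq hconn hV hx ha
    obtain ⟨P, hP, hPe⟩ := IsotropicSystem.exists_of_isInTightSeq hconn hV hcyc hseq
    refine ⟨P, ?_, hPe⟩
    rcases hP with h | h | h
    · exact Or.inl h
    · exact Or.inr (Or.inr (Or.inr (Or.inl h)))
    · exact Or.inr (Or.inr (Or.inr (Or.inr h)))
  · simp only [Set.iUnion_subset_iff]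
    rintro P (⟨⟨k, -, -, hP, -⟩, -⟩ | ⟨e, he, -, -, rfl⟩ | ⟨v, -, X, rfl, -, -, -, rfl⟩ |
      ⟨v, -, w, -, -, X, rfl, -, -, rfl⟩ | ⟨f, -, -, X, rfl, -, -, -, rfl⟩)
    · exact hP.2
    · exact Set.singleton_subset_iff.2 he
    · exact fun e he => he.1
    · exact fun e he => he.1
    · exact fun e he => he.1
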